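/- A finite set of points in the plane is in general position if no three of its points are collinear. For a finite set $\mathcal X$ in the plane, let $R_k$ be the set of vertices of the convex hull of $\mathcal X$, let $R_{k-1}$ be the set of vertices of the convex hull of $\mathcal X\setminus R_k$, and so on, until no point is left; $R_1,\dots,R_k$ are the convex layers of $\mathcal X$, with $R_1$ the innermost one and $k$ their number. Put $\mathcal X_j=R_1\cup\dots\cup R_j$ for $0\le j\le k$ (so $\mathcal X_0=\emptyset$). The set $\mathcal X$ is a nested almost convex set if, for every $1\le j\le k$: (1) $\mathcal X_j$ is in general position; (2) the vertices of the convex hull of $\mathcal X_j$ are the elements of $R_j$; (3) every triangle determined by three points of $R_j$ contains precisely one point of $\mathcal X_{j-1}$ in its interior. Two finite point sets have the same order type if there is a bijection between them that preserves the orientation (counterclockwise or clockwise) of all ordered triples. Theorem. Let $n\ge 0$ be an integer. If $n=2^{m-1}-2$ or $n=3\cdot 2^{m-1}-2$ for some integer $m\ge 1$, then there exists a nested almost convex set with $n$ points, and any two nested almost convex sets with $n$ points have the same order type; that is, there is exactly one order type of nested almost convex sets with $n$ points. For all other values of $n$, no nested almost convex set with $n$ points exists. (For $n=0$, which is $2^{m-1}-2$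 with $m=2$, the empty set is the only set in question and satisfies the conditions vacuously.) -/

import Mathlib

/-- The Euclidean plane. -/
abbrev Plane : Type := EuclideanSpace ℝ (Fin 2)

/-- No three distinct points of `S` are collinear. -/
def GeneralPosition (S : Set Plane) : Prop :=
  ∀ a ∈ S, ∀ b ∈ S, ∀ c ∈ S, a ≠ b → a ≠ c → b ≠ c → ¬ Collinear ℝ ({a, b, c} : Set Plane)

/-- The vertices of the convex hull of `S`. -/
def hullVertices (S : Set Plane) : Set Plane :=
  Set.extremePoints ℝ (convexHull ℝ S)

/-- Remove the outermost convex layer. -/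
def peel (S : Set Plane) : Set Plane :=
  S \ hullVertices S

/-- The number of convex layers of a finite point set: the number of times the outermost layer has
to be removed until nothing is left. -/
noncomputable def numLayers (X : Finset Plane) : ℕ :=
  sInf {i : ℕ | peel^[i] (X : Set Plane) = ∅}

/-- The `j`-th convex layer `R_j` of `X`, for `1 ≤ j ≤ numLayers X`, numbered from the inside:
`R_1` is the innermost one and `R_k`, with `k = numLayers X`, the outermost one. -/
noncomputable def layer (X : Finset Plane) (j : ℕ) : Set Plane :=
  hullVertices (peel^[numLayers X - j] (X : Set Plane))

/-- `X_j = R_1 ∪ ... ∪ R_j`; in particular `X_0 = ∅`. -/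
noncomputable def innerLayers (X : Finset Plane) (j : ℕ) : Set Plane :=
  ⋃ i ∈ Set.Icc 1 j, layer X i

/-- Nested almost convex sets. -/
structure IsNestedAlmostConvex (X : Finset Plane) : Prop where
  generalPosition : ∀ j, 1 ≤ j → j ≤ numLayers X → GeneralPosition (innerLayers X j)
  hullVertices_eq : ∀ j, 1 ≤ j → j ≤ numLayers X → hullVertices (innerLayers X j) = layer X j
  existsUnique_mem_triangle : ∀ j, 1 ≤ j → j ≤ numLayers X →
    ∀ a ∈ layer X j, ∀ b ∈ layer X j, ∀ c ∈ layer X j, a ≠ b → a ≠ c → b ≠ c →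
      ∃! p : Plane, p ∈ innerLayers X (j - 1) ∧ p ∈ interior (convexHull ℝ {a, b, c})

/-- The orientation of an ordered triple of points: `1` if `c` is to the left of the directed line
from `a` to `b` (counterclockwise), `-1` if it is to the right (clockwise), and `0` if the three
points are collinear. -/
noncomputable def orientation (a b c : Plane) : SignType :=
  SignType.sign ((b 0 - a 0) * (c 1 - a 1) - (b 1 - a 1) * (c 0 - a 0))

/-- Two finite point sets have the same order type if some bijection between them preserves the
orientation of all triples. -/
def SameOrderType (X Y : Finset Plane) : Prop :=
  ∃ f : X ≃ Y, ∀ a b c : X,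
    orientation (f a : Plane) (f b : Plane) (f c : Plane) = orientation (a : Plane) (b : Plane) (c : Plane)

/-! Everything is reduced to signs of `det3`. In general position a point of a finite set is a hull
vertex exactly when it lies in no triangle of the set (`mem_hullVertices_iff`), so the order type
determines the layers. By `isNestedAlmostConvex_iff` and `isNested_iff` the definition becomes a
recursion: `S` is nested when it is in general position, every triangle on its hull vertices `V`
contains exactly one point of `Q = peel S`, and `Q` is nested.

Size. If `S` has at least two points, the fan of triangles from one hull vertex has `|V| - 2`
members, each containing one point of `Q`, and each point of `Q` lies in exactly one of them. So
`|V| = |Q| + 2` (`ncard_hullVertices`) and `|S| + 2 = 2 (|Q| + 2)`. Starting from 0 or 1 points this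
yields the two families of sizes.

Uniqueness. Let `Q` have at least two points and let `U` be its hull vertices. The ear at each
vertex of `V` (the triangle with its two neighbours) contains one point, which belongs to `U`.
Applying the count to `S` and to `Q` gives `|V| = 2 |U|`, and ears at non-adjacent vertices contain
different points. Hence each `u` in `U` is the common point of the ears at the two ends of an edge
`l u`, `r u` of the hull, and these pairs partition `V` (`exists_isChildren`). This forces the order
type of `S` from that of `Q` (`IsChildren.isSplit`): for three different parents, replacing parents
by children does not change the orientation, and every point with another parent lies to the left of
the lines from `l u` to `u`, from `u` to `r u` and from `l u` to `r u`. An orientation-preserving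
bijection between inner parts therefore lifts to the whole sets.

Existence. Conversely, these orientation rules (`IsSplit`) imply nestedness (`IsSplit.peel_image`,
`IsSplit.outerTriangles`), and they are realised by placing two children very close to each hull
vertex of `Q`, almost along a supporting line and slightly outside it (`exists_isSplit`). -/

/-! ### Orientation determinants and triangles -/

/-- Twice the signed area of the triangle `a b c`. -/
def det3 (a b c : Plane) : ℝ :=
  (b 0 - a 0) * (c 1 - a 1) - (b 1 - a 1) * (c 0 - a 0)

/-- `p` lies strictly to the left of the three sides of the triangle `a b c`. -/
def InTri (p a b c : Plane) : Prop :=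
  0 < det3 a b p ∧ 0 < det3 b c p ∧ 0 < det3 c a p

lemma det3_rot (a b c : Plane) : det3 b c a = det3 a b c := by unfold det3; ring

lemma det3_swap (a b c : Plane) : det3 b a c = -det3 a b c := by unfold det3; ring

lemma det3_swap' (a b c : Plane) : det3 a c b = -det3 a b c := by unfold det3; ring

lemma det3_self (a b : Plane) : det3 a b b = 0 := by unfold det3; ring

lemma det3_self' (a b : Plane) : det3 a b a = 0 := by unfold det3; ring

lemma det3_self'' (a b : Plane) : det3 a a b = 0 := by unfold det3; ring

lemma det3_add (a b c p : Plane) : det3 a b p + det3 b c p + det3 c a p = det3 a b c := by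
  unfold det3; ring

/-- The determinants on the right are the unnormalised barycentric coordinates of `p` in `a b c`,
applied to the affine function `det3 x y`. -/
lemma det3_cramer (a b c p x y : Plane) :
    det3 a b c * det3 x y p =
      det3 b c p * det3 x y a + det3 c a p * det3 x y b + det3 a b p * det3 x y c := by
  unfold det3; ring

lemma InTri.rot {p a b c : Plane} (h : InTri p a b c) : InTri p b c a := ⟨h.2.1, h.2.2, h.1⟩

lemma InTri.det_pos {p a b c : Plane} (h : InTri p a b c) : 0 < det3 a b c := by
  have := det3_add a b c p
  linarith [h.1, h.2.1, h.2.2]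

lemma InTri.ne {p a b c : Plane} (h : InTri p a b c) : p ≠ a ∧ p ≠ b ∧ p ≠ c := by
  obtain ⟨h1, h2, h3⟩ := h
  refine ⟨?_, ?_, ?_⟩ <;> rintro rfl <;> simp [det3_self, det3_self'] at *

/-- By `det3_cramer`, `det3 x y p` is an average, with positive weights, of the values at the
vertices. This replaces all convexity arguments about lines and triangles below. -/
lemma InTri.pos {p a b c x y : Plane} (h : InTri p a b c) (ha : 0 ≤ det3 x y a)
    (hb : 0 ≤ det3 x y b) (hc : 0 ≤ det3 x y c)
    (hs : 0 < det3 x y a ∨ 0 < det3 x y b ∨ 0 < det3 x y c) : 0 < det3 x y p := by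
  have h0 := h.det_pos
  obtain ⟨h1, h2, h3⟩ := h
  have e := det3_cramer a b c p x y
  refine pos_of_mul_pos_right (a := det3 a b c) ?_ h0.le
  rw [e]
  have := mul_nonneg h2.le ha
  have := mul_nonneg h3.le hb
  have := mul_nonneg h1.le hc
  rcases hs with hs | hs | hs
  · have := mul_pos h2 hs; linarith
  · have := mul_pos h3 hs; linarith
  · have := mul_pos h1 hs; linarith

lemma InTri.neg {p a b c x y : Plane} (h : InTri p a b c) (ha : det3 x y a ≤ 0)
    (hb : det3 x y b ≤ 0) (hc : det3 x y c ≤ 0)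
    (hs : det3 x y a < 0 ∨ det3 x y b < 0 ∨ det3 x y c < 0) : det3 x y p < 0 := by
  have := h.pos (x := y) (y := x) (by rw [det3_swap]; linarith) (by rw [det3_swap]; linarith)
    (by rw [det3_swap]; linarith)
    (by rw [det3_swap x y, det3_swap x y, det3_swap x y]; simpa using hs)
  rw [det3_swap] at this; linarith

lemma InTri.mem_convexHull {p a b c : Plane} (h : InTri p a b c) :
    p ∈ convexHull ℝ ({a, b, c} : Set Plane) := by
  have h0 := h.det_pos
  have hs := det3_add a b c p
  obtain ⟨h1, h2, h3⟩ := h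
  rw [convexHull_insert (by simp)]
  rw [convexHull_pair, mem_convexJoin]
  refine ⟨a, rfl, (det3 c a p / (det3 c a p + det3 a b p)) • b +
    (det3 a b p / (det3 c a p + det3 a b p)) • c, ?_, ?_⟩
  · refine ⟨_, _, by positivity, by positivity, by field_simp, rfl⟩
  · refine ⟨det3 b c p / det3 a b c, (det3 c a p + det3 a b p) / det3 a b c, by positivity,
      by positivity, by field_simp; linarith, ?_⟩
    ext i
    simp only [PiLp.add_apply, PiLp.smul_apply, smul_eq_mul]
    field_simp
    fin_cases i <;> simp [det3] <;> ring

lemma convex_det3_nonneg (a b : Plane) : Convex ℝ {p | 0 ≤ det3 a b p} := by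
  intro x hx y hy s t hs ht hst
  simp only [Set.mem_ofPred_eq] at *
  have : det3 a b (s • x + t • y) = s * det3 a b x + t * det3 a b y := by
    have : t = 1 - s := by linarith
    subst this
    simp [det3]; ring
  rw [this]; positivity

lemma continuous_det3 {α : Type*} [TopologicalSpace α] {f g h : α → Plane} (hf : Continuous f)
    (hg : Continuous g) (hh : Continuous h) : Continuous fun x => det3 (f x) (g x) (h x) := by
  unfold det3; fun_prop

/-- A point on the line `a b` would leave the triangle when pushed slightly in the direction from
`c` to `a`, which an interior point does not. -/
lemma pos_of_mem_interior {a b c p : Plane} (h0 : 0 < det3 a b c)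
    (h : p ∈ interior (convexHull ℝ ({a, b, c} : Set Plane))) : 0 < det3 a b p := by
  have hsub : convexHull ℝ ({a, b, c} : Set Plane) ⊆ {p | 0 ≤ det3 a b p} := by
    refine convexHull_min ?_ (convex_det3_nonneg a b)
    rintro x (rfl | rfl | rfl) <;> simp [det3_self, det3_self', h0.le]
  have hp : 0 ≤ det3 a b p := hsub (interior_subset h)
  refine lt_of_le_of_ne hp fun he => ?_
  have hc : Filter.Tendsto (fun ε : ℝ => p - ε • (c - a)) (nhdsWithin 0 (Set.Ioi 0)) (nhds p) := by
    have : Continuous fun ε : ℝ => p - ε • (c - a) := by fun_prop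
    have := this.tendsto 0
    simp only [zero_smul, sub_zero] at this
    exact this.mono_left nhdsWithin_le_nhds
  have hev := hc (mem_interior_iff_mem_nhds.1 h)
  obtain ⟨ε, hε, hpos⟩ := ((Filter.mem_map.1 hev |> Filter.eventually_mem_set.2).and
    self_mem_nhdsWithin).exists
  have h1 := hsub hε
  have h2 : det3 a b (p - ε • (c - a)) = det3 a b p - ε * det3 a b c := by
    simp [det3]; ring
  simp only [Set.mem_ofPred_eq] at h1 hpos
  rw [h2, ← he] at h1
  have := mul_pos hpos h0
  linarith

lemma mem_interior_triangle_iff {a b c p : Plane} (h0 : 0 < det3 a b c) :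
    p ∈ interior (convexHull ℝ ({a, b, c} : Set Plane)) ↔ InTri p a b c := by
  constructor
  · intro h
    refine ⟨pos_of_mem_interior h0 h, ?_, ?_⟩
    · refine pos_of_mem_interior (c := a) (by rwa [det3_rot]) ?_
      convert h using 3; ext; simp; tauto
    · refine pos_of_mem_interior (c := b) (by rwa [det3_rot, det3_rot]) ?_
      convert h using 3; ext; simp; tauto
  · intro h
    have ho : IsOpen {p | InTri p a b c} := by
      refine IsOpen.inter ?_ (IsOpen.inter ?_ ?_) <;>
      exact isOpen_lt continuous_const (continuous_det3 continuous_const continuous_const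
        continuous_id)
    exact interior_maximal (fun x hx => InTri.mem_convexHull hx) ho h

lemma collinear_iff_det3 (a b c : Plane) : Collinear ℝ ({a, b, c} : Set Plane) ↔ det3 a b c = 0 := by
  rw [collinear_iff_of_mem (p₀ := a) (by simp)]
  constructor
  · rintro ⟨v, hv⟩
    obtain ⟨r, hr⟩ := hv b (by simp)
    obtain ⟨s, hs⟩ := hv c (by simp)
    rw [hr, hs]
    simp [det3]; ring
  · intro h
    by_cases hab : b = a
    · subst hab
      refine ⟨c - b, ?_⟩
      rintro p (rfl | rfl | rfl)
      · exact ⟨0, by simp⟩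
      · exact ⟨0, by simp⟩
      · exact ⟨1, by simp⟩
    · refine ⟨b - a, ?_⟩
      rintro p (rfl | rfl | rfl)
      · exact ⟨0, by simp⟩
      · exact ⟨1, by simp⟩
      · have hne : b 0 - a 0 ≠ 0 ∨ b 1 - a 1 ≠ 0 := by
          by_contra! hcon
          refine hab ?_
          ext i
          fin_cases i
          · simpa using sub_eq_zero.1 hcon.1
          · simpa using sub_eq_zero.1 hcon.2
        unfold det3 at h
        rcases hne with h1 | h1
        · refine ⟨(p 0 - a 0) / (b 0 - a 0), ?_⟩
          ext i
          fin_cases i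
          · simp; field_simp; ring
          · simp; field_simp; linarith
        · refine ⟨(p 1 - a 1) / (b 1 - a 1), ?_⟩
          ext i
          fin_cases i
          · simp; field_simp; linarith
          · simp; field_simp; ring

lemma GeneralPosition.det_ne {S : Set Plane} (h : GeneralPosition S) {a b c : Plane} (ha : a ∈ S)
    (hb : b ∈ S) (hc : c ∈ S) (hab : a ≠ b) (hac : a ≠ c) (hbc : b ≠ c) : det3 a b c ≠ 0 := by
  rw [Ne, ← collinear_iff_det3]
  exact h a ha b hb c hc hab hac hbc

lemma GeneralPosition.mono {S T : Set Plane} (h : GeneralPosition T) (hST : S ⊆ T) :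
    GeneralPosition S :=
  fun a ha b hb c hc => h a (hST ha) b (hST hb) c (hST hc)

/-! ### Hull vertices in terms of orientations -/

/-- Carathéodory gives an affinely independent subset of at most three points with `p` in its hull.
General position rules out single points, segments and the sides of a triangle; the vertices are
then listed counterclockwise. -/
lemma exists_inTri_of_mem_convexHull {T : Set Plane} {p : Plane}
    (hgp : GeneralPosition (insert p T)) (hpT : p ∉ T) (hp : p ∈ convexHull ℝ T) :
    ∃ a ∈ T, ∃ b ∈ T, ∃ c ∈ T, InTri p a b c := by
  rw [convexHull_eq_union] at hp
  simp only [Set.mem_iUnion] at hp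
  obtain ⟨t, htT, hai, hpt⟩ := hp
  have hcard : t.card ≤ 3 := by
    have := hai.card_le_finrank_succ
    have h2 : Module.finrank ℝ (vectorSpan ℝ (Set.range ((↑) : t → Plane))) ≤ 2 := by
      have := Submodule.finrank_le (vectorSpan ℝ (Set.range ((↑) : t → Plane)))
      simpa using this
    simp only [Fintype.card_coe] at this
    omega
  have hne : ∀ x ∈ t, p ≠ x := fun x hx he => hpT (he ▸ htT hx)
  have hpS : p ∈ insert p T := Set.mem_insert _ _
  have hS : ∀ x ∈ t, x ∈ insert p T := fun x hx => Set.mem_insert_of_mem _ (htT hx)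
  interval_cases hc : t.card
  · rw [Finset.card_eq_zero.1 hc] at hpt; simp at hpt
  · obtain ⟨a, rfl⟩ := Finset.card_eq_one.1 hc
    simp at hpt
    exact absurd hpt (hne a (by simp))
  · obtain ⟨a, b, hab, rfl⟩ := Finset.card_eq_two.1 hc
    exfalso
    have hcol : Collinear ℝ ({a, b, p} : Set Plane) := by
      have h1 : Collinear ℝ ({a, b} : Set Plane) := collinear_pair ℝ a b
      have h2 : p ∈ line[ℝ, a, b] := by
        have := convexHull_subset_affineSpan (𝕜 := ℝ) _ hpt
        simpa using this
      have := (collinear_insert_iff_of_mem_affineSpan h2).2 h1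
      convert this using 1
      ext; simp; tauto
    exact hgp a (hS a (by simp)) b (hS b (by simp)) p hpS hab (hne a (by simp)).symm
      (hne b (by simp)).symm hcol
  · obtain ⟨a, b, c, hab, hac, hbc, rfl⟩ := Finset.card_eq_three.1 hc
    have key : ∀ a b c : Plane, a ≠ b → a ≠ c → b ≠ c → a ∈ T → b ∈ T → c ∈ T →
        p ∈ convexHull ℝ ({a, b, c} : Set Plane) → 0 < det3 a b c → 0 < det3 a b p := by
      intro a b c hab hac hbc ha hb hc hp h0
      have hsub : convexHull ℝ ({a, b, c} : Set Plane) ⊆ {p | 0 ≤ det3 a b p} := by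
        refine convexHull_min ?_ (convex_det3_nonneg a b)
        rintro x (rfl | rfl | rfl) <;> simp [det3_self, det3_self', h0.le]
      refine lt_of_le_of_ne (hsub hp) (Ne.symm ?_)
      exact hgp.det_ne (Set.mem_insert_of_mem _ ha) (Set.mem_insert_of_mem _ hb) hpS hab
        (fun he => hpT (he ▸ ha)) (fun he => hpT (he ▸ hb))
    have main : ∀ a b c : Plane, a ≠ b → a ≠ c → b ≠ c → a ∈ T → b ∈ T → c ∈ T →
        p ∈ convexHull ℝ ({a, b, c} : Set Plane) → 0 < det3 a b c → InTri p a b c := by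
      intro a b c hab hac hbc ha hb hc hp h0
      refine ⟨key a b c hab hac hbc ha hb hc hp h0,
        key b c a hbc hab.symm hac.symm hb hc ha ?_ (by rwa [det3_rot]),
        key c a b hac.symm hbc.symm hab hc ha hb ?_ (by rwa [det3_rot, det3_rot])⟩ <;>
      · convert hp using 2; ext; simp; tauto
    have ha : a ∈ T := htT (by simp)
    have hb : b ∈ T := htT (by simp)
    have hcT : c ∈ T := htT (by simp)
    have hpt' : p ∈ convexHull ℝ ({a, b, c} : Set Plane) := by simpa using hpt
    rcases lt_trichotomy (det3 a b c) 0 with h | h | h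
    · refine ⟨a, ha, c, hcT, b, hb, main a c b hac hab hbc.symm ha hcT hb ?_ ?_⟩
      · convert hpt' using 2; ext; simp; tauto
      · rw [det3_swap']; linarith
    · exact absurd h (hgp.det_ne (hS a (by simp)) (hS b (by simp)) (hS c (by simp)) hab hac hbc)
    · exact ⟨a, ha, b, hb, c, hcT, main a b c hab hac hbc ha hb hcT hpt' h⟩

lemma hullVertices_subset (S : Set Plane) : hullVertices S ⊆ S := extremePoints_convexHull_subset

lemma peel_subset (S : Set Plane) : peel S ⊆ S := Set.sdiff_subset

lemma convexHull_hullVertices {S : Set Plane} (hS : S.Finite) :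
    convexHull ℝ (hullVertices S) = convexHull ℝ S := by
  have hc : IsCompact (convexHull ℝ S) := hS.isCompact_convexHull ℝ
  have h := closure_convexHull_extremePoints hc (convex_convexHull ℝ S)
  change closure (convexHull ℝ (hullVertices S)) = _ at h
  rwa [((hS.subset (hullVertices_subset S)).isCompact_convexHull ℝ).isClosed.closure_eq] at h

/-- An extreme point can be deleted from the hull without destroying convexity, so no triangle of
other points reaches it. Conversely, a point of `S` that is not extreme lies in the hull of the
extreme points, hence in one of their triangles. -/
lemma mem_hullVertices_iff {S : Set Plane} (hS : S.Finite) (hgp : GeneralPosition S) {p : Plane} :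
    p ∈ hullVertices S ↔ p ∈ S ∧ ∀ a ∈ S, ∀ b ∈ S, ∀ c ∈ S, ¬ InTri p a b c := by
  constructor
  · intro hp
    refine ⟨hullVertices_subset S hp, fun a ha b hb c hc h => ?_⟩
    have hconv := ((convex_convexHull ℝ S).mem_extremePoints_iff_convex_sdiff.1 hp).2
    have hsub : convexHull ℝ ({a, b, c} : Set Plane) ⊆ convexHull ℝ S \ {p} := by
      refine convexHull_min ?_ hconv
      rintro x (rfl | rfl | rfl)
      · exact ⟨subset_convexHull ℝ S ha, fun he => h.ne.1 he.symm⟩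
      · exact ⟨subset_convexHull ℝ S hb, fun he => h.ne.2.1 he.symm⟩
      · exact ⟨subset_convexHull ℝ S hc, fun he => h.ne.2.2 he.symm⟩
    exact (hsub h.mem_convexHull).2 rfl
  · rintro ⟨hpS, hp⟩
    by_contra hcon
    have hmem : p ∈ convexHull ℝ (hullVertices S) := by
      rw [convexHull_hullVertices hS]; exact subset_convexHull ℝ S hpS
    obtain ⟨a, ha, b, hb, c, hc, h⟩ := exists_inTri_of_mem_convexHull
      (hgp.mono (Set.insert_subset hpS (hullVertices_subset S))) hcon hmem
    exact hp a (hullVertices_subset S ha) b (hullVertices_subset S hb) c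
      (hullVertices_subset S hc) h

lemma exists_inTri_of_mem_peel {S : Set Plane} (hS : S.Finite) (hgp : GeneralPosition S) {p : Plane}
    (hp : p ∈ peel S) : ∃ a ∈ hullVertices S, ∃ b ∈ hullVertices S, ∃ c ∈ hullVertices S,
      InTri p a b c := by
  refine exists_inTri_of_mem_convexHull
    (hgp.mono (Set.insert_subset hp.1 (hullVertices_subset S))) hp.2 ?_
  rw [convexHull_hullVertices hS]
  exact subset_convexHull ℝ S hp.1

lemma hullVertices_nonempty {S : Set Plane} (hS : S.Finite) (hne : S.Nonempty) :
    (hullVertices S).Nonempty := by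
  have h := convexHull_hullVertices hS
  by_contra hcon
  rw [Set.not_nonempty_iff_eq_empty] at hcon
  rw [hcon, convexHull_empty] at h
  exact (hne.convexHull (𝕜 := ℝ)).ne_empty h.symm

/-! ### The recursive form of the definition -/

/-- Every counterclockwise triangle of hull vertices contains precisely one of the other points. -/
def OuterTriangles (S : Set Plane) : Prop :=
  ∀ a ∈ hullVertices S, ∀ b ∈ hullVertices S, ∀ c ∈ hullVertices S, 0 < det3 a b c →
    ∃! p, p ∈ peel S ∧ InTri p a b c

lemma outerTriangles_iff {S : Set Plane} (hgp : GeneralPosition S) :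
    OuterTriangles S ↔ ∀ a ∈ hullVertices S, ∀ b ∈ hullVertices S, ∀ c ∈ hullVertices S,
      a ≠ b → a ≠ c → b ≠ c →
      ∃! p : Plane, p ∈ peel S ∧ p ∈ interior (convexHull ℝ {a, b, c}) := by
  constructor
  · intro h a ha b hb c hc hab hac hbc
    have hne := hgp.det_ne (hullVertices_subset S ha) (hullVertices_subset S hb)
      (hullVertices_subset S hc) hab hac hbc
    rcases lt_or_gt_of_ne hne with h0 | h0
    · have h0' : 0 < det3 a c b := by rw [det3_swap']; linarith
      have : ({a, b, c} : Set Plane) = {a, c, b} := by ext; simp; tauto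
      rw [this]
      simpa only [mem_interior_triangle_iff h0'] using h a ha c hc b hb h0'
    · simpa only [mem_interior_triangle_iff h0] using h a ha b hb c hc h0
  · intro h a ha b hb c hc h0
    have := h a ha b hb c hc (by rintro rfl; simp [det3_self''] at h0)
      (by rintro rfl; simp [det3_self'] at h0) (by rintro rfl; simp [det3_self] at h0)
    simpa only [mem_interior_triangle_iff h0] using this

/-- Recursive form of being a nested almost convex set. -/
def IsNested (S : Set Plane) : Prop :=
  GeneralPosition S ∧ ∀ i, OuterTriangles (peel^[i] S)

lemma peel_iterate_subset (S : Set Plane) (i : ℕ) : peel^[i] S ⊆ S := by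
  induction i with
  | zero => exact subset_rfl
  | succ i ih => rw [Function.iterate_succ_apply']; exact (peel_subset _).trans ih

lemma ncard_peel_lt {S : Set Plane} (hS : S.Finite) (hne : S.Nonempty) :
    (peel S).ncard < S.ncard := by
  obtain ⟨p, hp⟩ := hullVertices_nonempty hS hne
  refine Set.ncard_lt_ncard ⟨peel_subset S, fun h => ?_⟩ hS
  exact (h (hullVertices_subset S hp)).2 hp

lemma peel_empty : peel ∅ = ∅ := by simp [peel]

/-- Each step removes a point from a nonempty set. This makes the `sInf` in `numLayers` a genuine
minimum and not the default value of an empty infimum. -/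
lemma exists_peel_iterate_eq_empty {S : Set Plane} (hS : S.Finite) : ∃ i, peel^[i] S = ∅ := by
  have key : ∀ i, peel^[i] S = ∅ ∨ (peel^[i] S).ncard + i ≤ S.ncard := by
    intro i
    induction i with
    | zero => right; simp
    | succ i ih =>
      rw [Function.iterate_succ_apply']
      rcases ih with h | h
      · left; rw [h, peel_empty]
      · rcases Set.eq_empty_or_nonempty (peel^[i] S) with h' | h'
        · left; rw [h', peel_empty]
        · have := ncard_peel_lt (hS.subset (peel_iterate_subset S i)) h'
          right; omega
  rcases key (S.ncard + 1) with h | h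
  · exact ⟨_, h⟩
  · omega

lemma peel_iterate_numLayers (X : Finset Plane) : peel^[numLayers X] (X : Set Plane) = ∅ :=
  Nat.sInf_mem (exists_peel_iterate_eq_empty X.finite_toSet)

/-- Adding layer `j + 1` back undoes one `peel`, so the induction runs outwards from the empty core.
-/
lemma innerLayers_eq (X : Finset Plane) {j : ℕ} (hj : j ≤ numLayers X) :
    innerLayers X j = peel^[numLayers X - j] (X : Set Plane) := by
  induction j with
  | zero => simp [innerLayers, peel_iterate_numLayers]
  | succ j ih =>
    have h1 : innerLayers X (j + 1) = innerLayers X j ∪ layer X (j + 1) := by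
      ext p
      simp only [innerLayers, Set.mem_iUnion, Set.mem_union, Set.mem_Icc, exists_prop]
      constructor
      · rintro ⟨i, ⟨hi1, hi2⟩, hp⟩
        rcases Nat.lt_or_ge j i with h | h
        · right; rwa [show j + 1 = i by omega]
        · exact Or.inl ⟨i, ⟨hi1, h⟩, hp⟩
      · rintro (⟨i, ⟨hi1, hi2⟩, hp⟩ | hp)
        · exact ⟨i, ⟨hi1, by omega⟩, hp⟩
        · exact ⟨j + 1, ⟨by omega, le_rfl⟩, hp⟩
    rw [h1, ih (by omega), layer, show numLayers X - j = (numLayers X - (j + 1)) + 1 by omega,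
      Function.iterate_succ_apply', peel, Set.sdiff_union_of_subset (hullVertices_subset _)]

/-- Once `innerLayers` is an iterated `peel`, condition (2) is the definition of a layer, and
general position of the whole set passes to all inner ones. -/
lemma isNestedAlmostConvex_iff (X : Finset Plane) :
    IsNestedAlmostConvex X ↔ IsNested (X : Set Plane) := by
  have hgpi : ∀ i, GeneralPosition (X : Set Plane) →
      GeneralPosition (peel^[i] (X : Set Plane)) := fun i h => h.mono (peel_iterate_subset _ i)
  have hpred : ∀ j, 1 ≤ j → j ≤ numLayers X →
      innerLayers X (j - 1) = peel (peel^[numLayers X - j] (X : Set Plane)) := by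
    intro j hj1 hj
    rw [innerLayers_eq X (by omega), ← Function.iterate_succ_apply' peel]
    congr 2; omega
  constructor
  · intro h
    have hgp : GeneralPosition (X : Set Plane) := by
      -- Without layers there is no index at which to use the hypothesis, but then `X` is empty.
      rcases Nat.eq_zero_or_pos (numLayers X) with h0 | h0
      · have := peel_iterate_numLayers X
        rw [h0] at this
        simp only [Function.iterate_zero, id] at this
        rw [this]
        intro a ha; simp at ha
      · have := h.generalPosition _ h0 le_rfl
        rwa [innerLayers_eq X le_rfl, Nat.sub_self] at this
    refine ⟨hgp, fun i => ?_⟩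
    rcases Nat.lt_or_ge i (numLayers X) with hi | hi
    · rw [outerTriangles_iff (hgpi i hgp)]
      have := h.existsUnique_mem_triangle (numLayers X - i) (by omega) (by omega)
      rw [hpred _ (by omega) (by omega), layer,
        show numLayers X - (numLayers X - i) = i by omega] at this
      exact this
    · have : peel^[i] (X : Set Plane) = ∅ := by
        have he : ∀ m, peel^[m] (∅ : Set Plane) = ∅ := fun m => by
          exact Set.subset_empty_iff.1 (peel_iterate_subset ∅ m)
        rw [show i = (i - numLayers X) + numLayers X by omega, Function.iterate_add_apply,
          peel_iterate_numLayers, he]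
      rw [this]
      intro a ha
      exact absurd (hullVertices_subset _ ha) (by simp)
  · rintro ⟨hgp, h⟩
    refine ⟨fun j hj1 hj => ?_, fun j hj1 hj => ?_, fun j hj1 hj => ?_⟩
    · rw [innerLayers_eq X hj]; exact hgpi _ hgp
    · rw [innerLayers_eq X hj, layer]
    · rw [hpred j hj1 hj, layer]
      exact (outerTriangles_iff (hgpi _ hgp)).1 (h _)

lemma isNested_iff (S : Set Plane) :
    IsNested S ↔ GeneralPosition S ∧ OuterTriangles S ∧ IsNested (peel S) := by
  constructor
  · rintro ⟨hgp, h⟩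
    exact ⟨hgp, h 0, hgp.mono (peel_subset S), fun i => h (i + 1)⟩
  · rintro ⟨hgp, h, -, h'⟩
    refine ⟨hgp, fun i => ?_⟩
    cases i with
    | zero => exact h
    | succ i => exact h' i

/-! ### Hull edges and the angular order around a hull vertex -/

lemma ne_of_det3_pos {a b c : Plane} (h : 0 < det3 a b c) : a ≠ b ∧ a ≠ c ∧ b ≠ c := by
  refine ⟨?_, ?_, ?_⟩ <;> rintro rfl <;> simp [det3_self, det3_self', det3_self''] at h

lemma not_inTri_of_mem_hullVertices {S : Set Plane} (hS : S.Finite) (hgp : GeneralPosition S)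
    {v a b c : Plane} (hv : v ∈ hullVertices S) (ha : a ∈ S) (hb : b ∈ S) (hc : c ∈ S) :
    ¬ InTri v a b c :=
  ((mem_hullVertices_iff hS hgp).1 hv).2 a ha b hb c hc

lemma GeneralPosition.pos_or_neg {S : Set Plane} (h : GeneralPosition S) {a b c : Plane}
    (ha : a ∈ S) (hb : b ∈ S) (hc : c ∈ S) (hab : a ≠ b) (hac : a ≠ c) (hbc : b ≠ c) :
    0 < det3 a b c ∨ det3 a b c < 0 :=
  (lt_or_gt_of_ne (h.det_ne ha hb hc hab hac hbc)).symm

/-- Seen from a hull vertex all other points fit into a half plane, so their angular order is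
linear: a cyclic triple would be a triangle around `v`. -/
lemma det3_trans {S : Set Plane} (hS : S.Finite) (hgp : GeneralPosition S) {v a b c : Plane}
    (hv : v ∈ hullVertices S) (ha : a ∈ S) (hb : b ∈ S) (hc : c ∈ S) (h1 : 0 < det3 v a b)
    (h2 : 0 < det3 v b c) : 0 < det3 v a c := by
  have hac : a ≠ c := by
    rintro rfl
    rw [det3_swap'] at h2; linarith
  rcases hgp.pos_or_neg (hullVertices_subset S hv) ha hc (ne_of_det3_pos h1).1
    (ne_of_det3_pos h2).2.1 hac with h | h
  · exact h
  · refine absurd ⟨?_, ?_, ?_⟩ (not_inTri_of_mem_hullVertices hS hgp hv ha hb hc)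
    · rwa [det3_rot]
    · rwa [det3_rot]
    · rw [det3_rot, det3_swap']; linarith

lemma exists_first {α : Type*} {s : Set α} (hs : s.Finite) (r : α → α → Prop) :
    s.Nonempty → (∀ a ∈ s, ∀ b ∈ s, a ≠ b → r a b ∨ r b a) →
    (∀ a ∈ s, ∀ b ∈ s, ∀ c ∈ s, r a b → r b c → r a c) → ∃ m ∈ s, ∀ b ∈ s, b ≠ m → r m b := by
  induction s, hs using Set.Finite.induction_on with
  | empty => simp
  | @insert a s has hs ih =>
    intro _ htot htr
    rcases s.eq_empty_or_nonempty with rfl | hne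
    · exact ⟨a, by simp, by simp⟩
    obtain ⟨m, hm, hmin⟩ := ih hne
      (fun x hx y hy => htot x (Set.mem_insert_of_mem _ hx) y (Set.mem_insert_of_mem _ hy))
      (fun x hx y hy z hz => htr x (Set.mem_insert_of_mem _ hx) y (Set.mem_insert_of_mem _ hy) z
        (Set.mem_insert_of_mem _ hz))
    have hma : a ≠ m := fun h => has (h ▸ hm)
    rcases htot a (Set.mem_insert _ _) m (Set.mem_insert_of_mem _ hm) hma with h | h
    · refine ⟨a, Set.mem_insert _ _, ?_⟩
      rintro b (rfl | hb) hba
      · exact absurd rfl hba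
      · by_cases hbm : b = m
        · rwa [hbm]
        · exact htr a (Set.mem_insert _ _) m (Set.mem_insert_of_mem _ hm) b
            (Set.mem_insert_of_mem _ hb) h (hmin b hb hbm)
    · refine ⟨m, Set.mem_insert_of_mem _ hm, ?_⟩
      rintro b (rfl | hb) hbm
      · exact h
      · exact hmin b hb hbm

/-- All other points of `S` lie to the left of the directed line from `v` to `w`. -/
def IsEdge (S : Set Plane) (v w : Plane) : Prop :=
  v ≠ w ∧ ∀ z ∈ S, z ≠ v → z ≠ w → 0 < det3 v w z

lemma IsEdge.nonneg {S : Set Plane} {v w : Plane} (h : IsEdge S v w) {z : Plane} (hz : z ∈ S) :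
    0 ≤ det3 v w z := by
  by_cases h1 : z = v
  · rw [h1, det3_self']
  by_cases h2 : z = w
  · rw [h2, det3_self]
  exact (h.2 z hz h1 h2).le

/-- All of `S` lies weakly to the left of the edge line and only `v` and `w` lie on it, whereas a
triangle has three distinct vertices. -/
lemma IsEdge.not_inTri {S : Set Plane} {v w p a b c : Plane} (h : IsEdge S v w)
    (hp : det3 v w p ≤ 0) (ha : a ∈ S) (hb : b ∈ S) (hc : c ∈ S) : ¬ InTri p a b c := by
  intro hT
  have hne := ne_of_det3_pos hT.det_pos
  have key : ¬ (0 < det3 v w a ∨ 0 < det3 v w b ∨ 0 < det3 v w c) := fun hs =>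
    absurd (hT.pos (h.nonneg ha) (h.nonneg hb) (h.nonneg hc) hs) (not_lt.2 hp)
  push Not at key
  have mem : ∀ x ∈ S, det3 v w x ≤ 0 → x = v ∨ x = w := fun x hx hx0 => by
    by_contra! hcon
    exact absurd (h.2 x hx hcon.1 hcon.2) (not_lt.2 hx0)
  rcases mem a ha key.1 with rfl | rfl <;> rcases mem b hb key.2.1 with rfl | rfl <;>
    rcases mem c hc key.2.2 with rfl | rfl <;> simp at hne

lemma IsEdge.mem_hullVertices {S : Set Plane} (hS : S.Finite) (hgp : GeneralPosition S)
    {v w : Plane} (h : IsEdge S v w) (hv : v ∈ S) (hw : w ∈ S) :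
    v ∈ hullVertices S ∧ w ∈ hullVertices S := by
  rw [mem_hullVertices_iff hS hgp, mem_hullVertices_iff hS hgp]
  exact ⟨⟨hv, fun a ha b hb c hc => h.not_inTri (by rw [det3_self']) ha hb hc⟩,
    hw, fun a ha b hb c hc => h.not_inTri (by rw [det3_self]) ha hb hc⟩

/-- The successor of `v` on the hull is the first point in the angular order around `v`. -/
lemma exists_isEdge_left {S : Set Plane} (hS : S.Finite) (hgp : GeneralPosition S)
    (hnt : S.Nontrivial) {v : Plane} (hv : v ∈ hullVertices S) :
    ∃ w ∈ hullVertices S, IsEdge S v w := by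
  obtain ⟨x, hx, hxv⟩ := hnt.exists_ne v
  have hvS := hullVertices_subset S hv
  obtain ⟨w, hw, hmin⟩ := exists_first (s := S \ {v}) (hS.subset Set.sdiff_subset)
    (fun a b => 0 < det3 v a b) ⟨x, hx, hxv⟩
    (fun a ha b hb hab => by
      rcases hgp.pos_or_neg hvS ha.1 hb.1 (Ne.symm ha.2) (Ne.symm hb.2) hab with h | h
      · exact Or.inl h
      · right; rw [det3_swap']; linarith)
    (fun a ha b hb c hc => det3_trans hS hgp hv ha.1 hb.1 hc.1)
  have he : IsEdge S v w := ⟨Ne.symm hw.2, fun z hz hzv hzw => hmin z ⟨hz, hzv⟩ hzw⟩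
  exact ⟨w, (he.mem_hullVertices hS hgp hvS hw.1).2, he⟩

lemma exists_isEdge_right {S : Set Plane} (hS : S.Finite) (hgp : GeneralPosition S)
    (hnt : S.Nontrivial) {v : Plane} (hv : v ∈ hullVertices S) :
    ∃ w ∈ hullVertices S, IsEdge S w v := by
  obtain ⟨x, hx, hxv⟩ := hnt.exists_ne v
  have hvS := hullVertices_subset S hv
  obtain ⟨w, hw, hmin⟩ := exists_first (s := S \ {v}) (hS.subset Set.sdiff_subset)
    (fun a b => 0 < det3 v b a) ⟨x, hx, hxv⟩
    (fun a ha b hb hab => by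
      rcases hgp.pos_or_neg hvS ha.1 hb.1 (Ne.symm ha.2) (Ne.symm hb.2) hab with h | h
      · exact Or.inr h
      · left; rw [det3_swap']; linarith)
    (fun a ha b hb c hc h1 h2 => det3_trans hS hgp hv hc.1 hb.1 ha.1 h2 h1)
  have he : IsEdge S w v := ⟨hw.2, fun z hz hzw hzv => by
    rw [← det3_rot]
    exact hmin z ⟨hz, hzv⟩ hzw⟩
  exact ⟨w, (he.mem_hullVertices hS hgp hw.1 hvS).1, he⟩

lemma IsEdge.right_unique {S : Set Plane} {v w w' : Plane} (h : IsEdge S v w)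
    (h' : IsEdge S v w') (hw : w ∈ S) (hw' : w' ∈ S) : w = w' := by
  by_contra hne
  have h1 := h.2 w' hw' h'.1.symm (Ne.symm hne)
  have h2 := h'.2 w hw h.1.symm hne
  rw [det3_swap'] at h2; linarith

lemma IsEdge.left_unique {S : Set Plane} {v v' w : Plane} (h : IsEdge S v w)
    (h' : IsEdge S v' w) (hv : v ∈ S) (hv' : v' ∈ S) : v = v' := by
  by_contra hne
  have h1 := h.2 v' hv' (Ne.symm hne) h'.1
  have h2 := h'.2 v hv hne h.1
  linarith [det3_swap w v' v, det3_rot v w v']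

/-! ### Counting hull vertices with a fan -/

/-- Take for `a` the last hull vertex that precedes `q` in the angular order around `v`, and for `b`
its successor on the hull; by maximality `b` comes after `q`. -/
lemma exists_fan_triangle {S : Set Plane} (hS : S.Finite) (hgp : GeneralPosition S)
    {v q : Plane} (hv : v ∈ hullVertices S) (hq : q ∈ peel S) :
    ∃ a ∈ hullVertices S, ∃ b ∈ hullVertices S, IsEdge S a b ∧ a ≠ v ∧ b ≠ v ∧ InTri q v a b := by
  have hvS := hullVertices_subset S hv
  have hqv : ∀ x ∈ hullVertices S, q ≠ x := fun x hx h => hq.2 (h ▸ hx)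
  have hnt : S.Nontrivial := ⟨v, hvS, q, hq.1, (hqv v hv).symm⟩
  obtain ⟨n, hn, hne⟩ := exists_isEdge_left hS hgp hnt hv
  obtain ⟨a, ha, hmax⟩ := exists_first (s := {a | a ∈ hullVertices S ∧ 0 < det3 v a q})
    (hS.subset fun a ha => hullVertices_subset S ha.1)
    (fun a b => 0 < det3 v b a) ⟨n, hn, hne.2 q hq.1 (hqv v hv) (hqv n hn)⟩
    (fun a ha b hb hab => by
      rcases hgp.pos_or_neg hvS (hullVertices_subset S ha.1) (hullVertices_subset S hb.1)
        (ne_of_det3_pos ha.2).1 (ne_of_det3_pos hb.2).1 hab with h | h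
      · exact Or.inr h
      · left; rw [det3_swap']; linarith)
    (fun a ha b hb c hc h1 h2 => det3_trans hS hgp hv (hullVertices_subset S hc.1)
      (hullVertices_subset S hb.1) (hullVertices_subset S ha.1) h2 h1)
  obtain ⟨b, hb, hab⟩ := exists_isEdge_left hS hgp hnt ha.1
  have haS := hullVertices_subset S ha.1
  have hbS := hullVertices_subset S hb
  have hav : a ≠ v := (ne_of_det3_pos ha.2).1.symm
  have habq := hab.2 q hq.1 (hqv a ha.1) (hqv b hb)
  have hbv : b ≠ v := by
    rintro rfl
    have := ha.2
    rw [det3_swap] at this; linarith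
  refine ⟨a, ha.1, b, hb, hab, hav, hbv, ha.2, habq, ?_⟩
  rcases hgp.pos_or_neg hbS hvS hq.1 hbv (hqv b hb).symm (hqv v hv).symm with h | h
  · exact h
  · exfalso
    have h1 : 0 < det3 v b q := by rw [det3_swap]; linarith
    have h2 := hmax b ⟨hb, h1⟩ hab.1.symm
    have h3 := hab.2 v hvS hav.symm hbv.symm
    linarith [det3_rot v a b, det3_swap' v a b]

/-- With `p` the predecessor of `v`, each hull vertex other than `v` and `p` starts one triangle of
the fan from `v`. Sending it to the unique inner point of that triangle is a bijection onto `peel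
S`. -/
lemma ncard_hullVertices {S : Set Plane} (hS : S.Finite) (hgp : GeneralPosition S)
    (hT : OuterTriangles S) (hnt : S.Nontrivial) :
    (hullVertices S).ncard = (peel S).ncard + 2 := by
  have hVfin : (hullVertices S).Finite := hS.subset (hullVertices_subset S)
  obtain ⟨v, hv⟩ := hullVertices_nonempty hS hnt.nonempty
  have hvS := hullVertices_subset S hv
  obtain ⟨p, hp, hpe⟩ := exists_isEdge_right hS hgp hnt hv
  have hpS := hullVertices_subset S hp
  have hψ : ∀ a ∈ hullVertices S \ {v, p}, ∃ q, q ∈ peel S ∧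
      ∃ b ∈ hullVertices S, IsEdge S a b ∧ a ≠ v ∧ b ≠ v ∧ InTri q v a b := by
    rintro a ⟨ha, hap⟩
    simp only [Set.mem_insert_iff, Set.mem_singleton_iff, not_or] at hap
    obtain ⟨b, hb, hab⟩ := exists_isEdge_left hS hgp hnt ha
    have hbv : b ≠ v := by
      rintro rfl
      exact hap.2 (hab.left_unique hpe (hullVertices_subset S ha) hpS)
    have h1 := hab.2 v hvS (Ne.symm hap.1) hbv.symm
    rw [det3_rot v a b] at h1
    obtain ⟨q, ⟨hq, hqT⟩, -⟩ := hT v hv a ha b hb h1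
    exact ⟨q, hq, b, hb, hab, hap.1, hbv, hqT⟩
  choose! ψ hψQ hψT using hψ
  have hcard : (hullVertices S \ {v, p}).ncard = (peel S).ncard := by
    refine Set.ncard_congr (fun a _ => ψ a) hψQ ?_ ?_
    · intro a a' ha ha' heq
      by_contra hne
      -- If `a'` came after `a`, it would also come before `b`, since the common point comes after
      -- `a'` and before `b`; then the hull vertex `a'` would lie inside `v a b`.
      have key : ∀ a ∈ hullVertices S \ {v, p}, ∀ a' ∈ hullVertices S \ {v, p}, ψ a = ψ a' →
          a ≠ a' → ¬ 0 < det3 v a a' := by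
        intro a ha a' ha' heq hne hd
        obtain ⟨b, hb, hab, hav, hbv, h⟩ := hψT a ha
        obtain ⟨b', -, -, -, -, h'⟩ := hψT a' ha'
        rw [heq] at h
        have haS := hullVertices_subset S ha.1
        have haS' := hullVertices_subset S ha'.1
        have hbS := hullVertices_subset S hb
        have hqb : det3 v b (ψ a') < 0 := by
          have := h.2.2
          rw [det3_swap] at this; linarith
        have hba' : b ≠ a' := by
          rintro rfl
          linarith [h'.1]
        have hbn : ¬ 0 < det3 v b a' := fun hd' => by
          have := det3_trans hS hgp hv hbS haS' (hψQ a' ha').1 hd' h'.1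
          linarith
        have hbp : det3 v b a' < 0 :=
          (hgp.pos_or_neg hvS hbS haS' hbv.symm (ne_of_det3_pos h'.1).1 hba').resolve_left hbn
        refine not_inTri_of_mem_hullVertices hS hgp ha'.1 hvS haS hbS ⟨hd, ?_, ?_⟩
        · exact hab.2 a' haS' (Ne.symm hne) hba'.symm
        · rw [det3_swap]; linarith
      have h1 := key a ha a' ha' heq hne
      have h2 := key a' ha' a ha heq.symm (Ne.symm hne)
      obtain ⟨_, _, _, hav, _, _⟩ := hψT a ha
      obtain ⟨_, _, _, hav', _, _⟩ := hψT a' ha'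
      rcases hgp.pos_or_neg hvS (hullVertices_subset S ha.1) (hullVertices_subset S ha'.1)
        hav.symm hav'.symm hne with h | h
      · exact h1 h
      · rw [det3_swap'] at h; exact h2 (by linarith)
    · intro q hq
      obtain ⟨a, ha, b, hb, hab, hav, hbv, h⟩ := exists_fan_triangle hS hgp hv hq
      have hap : a ≠ p := by
        rintro rfl
        exact hbv (hab.right_unique hpe (hullVertices_subset S hb) hvS)
      have haA : a ∈ hullVertices S \ {v, p} := ⟨ha, by simp [hav, hap]⟩
      refine ⟨a, haA, ?_⟩
      obtain ⟨b', hb', hab', -, -, h'⟩ := hψT a haA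
      obtain rfl := hab.right_unique hab' (hullVertices_subset S hb) (hullVertices_subset S hb')
      exact (hT v hv a ha b hb h.det_pos).unique ⟨hψQ a haA, h'⟩ ⟨hq, h⟩
  have hsub : ({v, p} : Set Plane) ⊆ hullVertices S := by
    rintro x (rfl | rfl) <;> assumption
  have := Set.ncard_sdiff_add_ncard_of_subset hsub hVfin
  rw [Set.ncard_pair hpe.1.symm, hcard] at this
  omega

lemma ncard_eq_two_mul_add_two {S : Set Plane} (hS : S.Finite) (hgp : GeneralPosition S)
    (hT : OuterTriangles S) (hnt : S.Nontrivial) : S.ncard = 2 * (peel S).ncard + 2 := by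
  have h1 := ncard_hullVertices hS hgp hT hnt
  have h2 := Set.ncard_sdiff_add_ncard_of_subset (hullVertices_subset S) hS
  change (peel S).ncard + _ = _ at h2
  omega

/-- The fan triangle at `v` around `q` does not contain `q'`, and its outer side is a hull edge, so
one of its two sides through `v` separates the points. -/
lemma exists_separating_vertex {S : Set Plane} (hS : S.Finite) (hgp : GeneralPosition S)
    (hT : OuterTriangles S) {v q q' : Plane} (hv : v ∈ hullVertices S) (hq : q ∈ peel S)
    (hq' : q' ∈ peel S) (hne : q ≠ q') : ∃ w ∈ hullVertices S, w ≠ v ∧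
      (0 < det3 v w q ∧ det3 v w q' < 0 ∨ det3 v w q < 0 ∧ 0 < det3 v w q') := by
  obtain ⟨a, ha, b, hb, hab, hav, hbv, h⟩ := exists_fan_triangle hS hgp hv hq
  have hqv : ∀ x ∈ hullVertices S, q' ≠ x := fun x hx h => hq'.2 (h ▸ hx)
  have hvS := hullVertices_subset S hv
  rcases hgp.pos_or_neg hvS (hullVertices_subset S ha) hq'.1 hav.symm (hqv v hv).symm
    (hqv a ha).symm with h1 | h1
  · rcases hgp.pos_or_neg (hullVertices_subset S hb) hvS hq'.1 hbv (hqv b hb).symm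
      (hqv v hv).symm with h2 | h2
    · exact absurd ((hT v hv a ha b hb h.det_pos).unique ⟨hq, h⟩
        ⟨hq', h1, hab.2 q' hq'.1 (hqv a ha) (hqv b hb), h2⟩) hne
    · have h3 := h.2.2
      rw [det3_swap] at h2 h3
      exact ⟨b, hb, hbv, Or.inr ⟨by linarith, by linarith⟩⟩
  · exact ⟨a, ha, hav, Or.inl ⟨h.1, h1⟩⟩

/-! ### Ears of the hull and children -/

/-- The line `n p` cuts off the ear at `v`; a hull vertex on the near side would lie inside that
ear. -/
lemma det3_neg_of_edges {S : Set Plane} (hS : S.Finite) (hgp : GeneralPosition S)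
    {p v n z : Plane} (hp : p ∈ S) (hv : v ∈ S) (hn : n ∈ S) (hpv : IsEdge S p v)
    (hvn : IsEdge S v n) (hpn : p ≠ n) (hz : z ∈ hullVertices S) (hzp : z ≠ p) (hzv : z ≠ v)
    (hzn : z ≠ n) : det3 n p z < 0 := by
  have hzS := hullVertices_subset S hz
  refine (hgp.pos_or_neg hn hp hzS hpn.symm hzn.symm hzp.symm).resolve_left fun h => ?_
  exact not_inTri_of_mem_hullVertices hS hgp hz hp hv hn
    ⟨hpv.2 z hzS hzp hzv, hvn.2 z hzS hzv hzn, h⟩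

/-- The triangle cut off by two consecutive hull edges contains exactly one further point, which
is a vertex of the next layer. -/
lemma exists_ear_point {S : Set Plane} (hS : S.Finite) (hgp : GeneralPosition S)
    (hT : OuterTriangles S) {p v n : Plane} (hp : p ∈ hullVertices S) (hv : v ∈ hullVertices S)
    (hn : n ∈ hullVertices S) (hpv : IsEdge S p v) (hvn : IsEdge S v n) (hpn : p ≠ n) :
    ∃ u ∈ hullVertices (peel S), InTri u p v n := by
  have hpS := hullVertices_subset S hp
  have hvS := hullVertices_subset S hv
  have hnS := hullVertices_subset S hn
  have hqv : ∀ q ∈ peel S, ∀ x ∈ hullVertices S, q ≠ x := fun q hq x hx h => hq.2 (h ▸ hx)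
  have h0 : 0 < det3 p v n := hpv.2 n hnS hpn.symm hvn.1.symm
  obtain ⟨u, ⟨hu, huT⟩, huniq⟩ := hT p hp v hv n hn h0
  -- All other points of `peel S` lie beyond the line `n p` and `u` lies on the near side, so no
  -- triangle of them contains `u`.
  have hneg : ∀ z ∈ peel S, z ≠ u → det3 n p z < 0 := by
    intro z hz hzu
    refine (hgp.pos_or_neg hnS hpS hz.1 hpn.symm (hqv z hz n hn).symm
      (hqv z hz p hp).symm).resolve_left fun h => hzu (huniq z ⟨hz, ?_, ?_, h⟩)
    · exact hpv.2 z hz.1 (hqv z hz p hp) (hqv z hz v hv)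
    · exact hvn.2 z hz.1 (hqv z hz v hv) (hqv z hz n hn)
  refine ⟨u, (mem_hullVertices_iff (hS.subset (peel_subset S))
    (hgp.mono (peel_subset S))).2 ⟨hu, fun a ha b hb c hc h => ?_⟩, huT⟩
  have ha' := hneg a ha h.ne.1.symm
  have hb' := hneg b hb h.ne.2.1.symm
  have hc' := hneg c hc h.ne.2.2.symm
  exact lt_asymm (h.neg ha'.le hb'.le hc'.le (Or.inl ha')) huT.2.2

/-- The intersection of the ears at `l` and `r` lies in every triangle on the edge `l r`: the line
`r x` has the first ear on its left and the line `x l` the second, because `x` is beyond both `p r`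
and `l n`. -/
lemma inTri_edge_of_mem_ears {S : Set Plane} (hS : S.Finite) (hgp : GeneralPosition S)
    {p l r n u x : Plane} (hp : p ∈ S) (hl : l ∈ S) (hr : r ∈ S) (hn : n ∈ S)
    (hpl : IsEdge S p l) (hlr : IsEdge S l r) (hrn : IsEdge S r n) (hpr : p ≠ r) (hln : l ≠ n)
    (h1 : InTri u p l r) (h2 : InTri u l r n) (hx : x ∈ hullVertices S) (hxl : x ≠ l)
    (hxr : x ≠ r) : InTri u l r x := by
  have hxS := hullVertices_subset S hx
  have hd := hlr.2 x hxS hxl hxr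
  refine ⟨h2.1, ?_, ?_⟩
  · refine h1.pos ?_ ?_ ?_ (Or.inr (Or.inl ?_))
    · by_cases h : x = p
      · rw [h, det3_self]
      · have := det3_neg_of_edges hS hgp hp hl hr hpl hlr hpr hx h hxl hxr
        rw [det3_swap'] at this; linarith
    · rw [det3_rot]; exact hd.le
    · rw [det3_self']
    · rw [det3_rot]; exact hd
  · refine h2.pos ?_ ?_ ?_ (Or.inr (Or.inl ?_))
    · rw [det3_self]
    · rw [← det3_rot]; exact hd.le
    · by_cases h : x = n
      · rw [h, det3_self']
      · have := det3_neg_of_edges hS hgp hl hr hn hlr hrn hln hx hxl hxr h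
        linarith [det3_rot x n l, det3_swap' x n l]
    · rw [← det3_rot]; exact hd

/-- The ear at a vertex `w` that is not a neighbour of `v` does not use `v`, hence lies beyond the
line `n p` that cuts off the ear at `v`. -/
lemma adjacent_of_common_ear_point {S : Set Plane} (hS : S.Finite) (hgp : GeneralPosition S)
    {p v n p' w n' u : Plane} (hp : p ∈ S) (hv : v ∈ S) (hn : n ∈ S) (hpv : IsEdge S p v)
    (hvn : IsEdge S v n) (hpn : p ≠ n) (hp' : p' ∈ hullVertices S) (hw : w ∈ hullVertices S)
    (hn' : n' ∈ hullVertices S) (hpv' : IsEdge S p' w) (hvn' : IsEdge S w n')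
    (h : InTri u p v n) (h' : InTri u p' w n') (hvw : v ≠ w) : w = n ∨ w = p := by
  by_contra! hcon
  have hwS := hullVertices_subset S hw
  have key : ∀ z ∈ hullVertices S, z ≠ v → det3 n p z ≤ 0 := by
    intro z hz hzv
    by_cases h1 : z = p
    · rw [h1, det3_self]
    by_cases h2 : z = n
    · rw [h2, det3_self']
    exact (det3_neg_of_edges hS hgp hp hv hn hpv hvn hpn hz h1 hzv h2).le
  have hp'v : p' ≠ v := by
    rintro rfl
    exact hcon.1 (hpv'.right_unique hvn hwS hn)
  have hn'v : n' ≠ v := by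
    rintro rfl
    exact hcon.2 (hvn'.left_unique hpv hwS hp)
  have hneg := det3_neg_of_edges hS hgp hp hv hn hpv hvn hpn hw hcon.2 hvw.symm hcon.1
  exact lt_asymm (h'.neg (key p' hp' hp'v) (key w hw hvw.symm) (key n' hn' hn'v)
    (Or.inr (Or.inl hneg))) h.2.2

/-- Fibres have at most two elements and their sizes add up to `2 |U|`, so each has exactly two. -/
lemma exists_pair_of_two_to_one {α β : Type*} {V : Set α} {U : Set β} (hV : V.Finite)
    (hU : U.Finite) (e : α → β) (he : Set.MapsTo e V U) (hcard : V.ncard = 2 * U.ncard)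
    (h3 : ∀ a ∈ V, ∀ b ∈ V, ∀ c ∈ V, a ≠ b → a ≠ c → b ≠ c → e a = e b → e a = e c → False) :
    ∀ u ∈ U, ∃ a ∈ V, ∃ b ∈ V, a ≠ b ∧ e a = u ∧ e b = u ∧ ∀ c ∈ V, e c = u → c = a ∨ c = b := by
  classical
  lift V to Finset α using hV
  lift U to Finset β using hU
  simp only [Set.ncard_coe_finset] at hcard
  simp only [Finset.mem_coe] at *
  have hsum := Finset.card_eq_sum_card_fiberwise he
  have hle : ∀ u ∈ U, (V.filter fun a => e a = u).card ≤ 2 := by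
    intro u _
    by_contra! hcon
    obtain ⟨a, b, c, ha, hb, hc, hab, hac, hbc⟩ := Finset.two_lt_card_iff.1 hcon
    simp only [Finset.mem_filter] at ha hb hc
    exact h3 a ha.1 b hb.1 c hc.1 hab hac hbc (ha.2.trans hb.2.symm) (ha.2.trans hc.2.symm)
  have heq : ∀ u ∈ U, (V.filter fun a => e a = u).card = 2 := by
    refine (Finset.sum_eq_sum_iff_of_le hle).1 ?_
    rw [← hsum, hcard]; simp [mul_comm]
  intro u hu
  obtain ⟨a, b, hab, h⟩ := Finset.card_eq_two.1 (heq u hu)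
  have hmem : ∀ c, c ∈ V ∧ e c = u ↔ c = a ∨ c = b := fun c => by
    simpa [Finset.mem_filter] using Finset.ext_iff.1 h c
  exact ⟨a, ((hmem a).2 (Or.inl rfl)).1, b, ((hmem b).2 (Or.inr rfl)).1, hab,
    ((hmem a).2 (Or.inl rfl)).2, ((hmem b).2 (Or.inr rfl)).2, fun c hc hcu => (hmem c).1 ⟨hc, hcu⟩⟩

/-- The points `l u`, `r u` are the two consecutive vertices of the hull of `S` that lie next to
the vertex `u` of the hull of `peel S`. -/
structure IsChildren (S : Set Plane) (l r : Plane → Plane) : Prop where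
  left_mem : ∀ u ∈ hullVertices (peel S), l u ∈ hullVertices S
  right_mem : ∀ u ∈ hullVertices (peel S), r u ∈ hullVertices S
  isEdge : ∀ u ∈ hullVertices (peel S), IsEdge S (l u) (r u)
  inTri : ∀ u ∈ hullVertices (peel S), ∀ x ∈ hullVertices S, x ≠ l u → x ≠ r u →
    InTri u (l u) (r u) x
  disjoint : ∀ u ∈ hullVertices (peel S), ∀ w ∈ hullVertices (peel S), u ≠ w →
    l u ≠ l w ∧ l u ≠ r w ∧ r u ≠ r w
  surj : ∀ v ∈ hullVertices S, ∃ u ∈ hullVertices (peel S), v = l u ∨ v = r u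

/-- Let `e` send a hull vertex to the point in its ear. The counts for `S` and `peel S` make the
source twice as large as the target, and a fibre consists of pairwise adjacent vertices. There are
at least four hull vertices, so three cannot be pairwise adjacent, and every fibre is a hull edge.
-/
lemma exists_isChildren {S : Set Plane} (hS : S.Finite) (hgp : GeneralPosition S)
    (hT : OuterTriangles S) (hT' : OuterTriangles (peel S)) (hnt : (peel S).Nontrivial) :
    ∃ l r, IsChildren S l r := by
  have hQ := hS.subset (peel_subset S)
  have hgpQ := hgp.mono (peel_subset S)
  have hntS := hnt.mono (peel_subset S)
  have hcV := ncard_hullVertices hS hgp hT hntS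
  have hcQ := ncard_eq_two_mul_add_two hQ hgpQ hT' hnt
  have hcU := ncard_hullVertices hQ hgpQ hT' hnt
  have hVfin := hS.subset (hullVertices_subset S)
  have hVS := hullVertices_subset S
  choose! nx hnx hnxe using fun v hv => exists_isEdge_left hS hgp hntS (v := v) hv
  choose! pv hpv hpve using fun v hv => exists_isEdge_right hS hgp hntS (v := v) hv
  have hpn : ∀ v ∈ hullVertices S, pv v ≠ nx v := by
    intro v hv heq
    have hex : ∃ z ∈ hullVertices S, z ∉ ({v, nx v} : Set Plane) := by
      by_contra! hcon
      have := Set.ncard_le_ncard (t := {v, nx v}) hcon (by simp)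
      have := Set.ncard_insert_le v {nx v}
      rw [Set.ncard_singleton] at this
      omega
    obtain ⟨z, hz, hzn⟩ := hex
    simp only [Set.mem_insert_iff, Set.mem_singleton_iff, not_or] at hzn
    have h1 := (hnxe v hv).2 z (hVS hz) hzn.1 hzn.2
    have h2 := (hpve v hv).2 z (hVS hz) (by rw [heq]; exact hzn.2) hzn.1
    rw [heq, det3_swap] at h2; linarith
  choose! e heU heT using fun v hv => exists_ear_point hS hgp hT (hpv v hv) hv (hnx v hv)
    (hpve v hv) (hnxe v hv) (hpn v hv)
  have hadj : ∀ v ∈ hullVertices S, ∀ w ∈ hullVertices S, e v = e w → v ≠ w →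
      w = nx v ∨ w = pv v := by
    intro v hv w hw hvw hne
    refine adjacent_of_common_ear_point hS hgp (hVS (hpv v hv)) (hVS hv) (hVS (hnx v hv))
      (hpve v hv) (hnxe v hv) (hpn v hv) (hpv w hw) hw (hnx w hw) (hpve w hw) (hnxe w hw)
      (heT v hv) (hvw ▸ heT w hw) hne
  have hadj' : ∀ v ∈ hullVertices S, ∀ w ∈ hullVertices S, e v = e w → v ≠ w →
      IsEdge S v w ∨ IsEdge S w v := by
    intro v hv w hw hvw hne
    rcases hadj v hv w hw hvw hne with rfl | rfl
    · exact Or.inl (hnxe v hv)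
    · exact Or.inr (hpve v hv)
  -- A fourth hull vertex would lie inside a closed triangle of hull edges.
  have hcycle : ∀ a ∈ hullVertices S, ∀ b ∈ hullVertices S, ∀ c ∈ hullVertices S,
      ¬ (IsEdge S a b ∧ IsEdge S b c ∧ IsEdge S c a) := by
    rintro a ha b hb c hc ⟨h1, h2, h3⟩
    have hex : ∃ z ∈ hullVertices S, z ∉ ({a, b, c} : Set Plane) := by
      by_contra! hcon
      have := Set.ncard_le_ncard (t := {a, b, c}) hcon (by simp)
      have h3 : ({a, b, c} : Set Plane).ncard ≤ 3 := by
        refine (Set.ncard_insert_le _ _).trans ?_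
        have := Set.ncard_insert_le b {c}
        rw [Set.ncard_singleton] at this
        omega
      omega
    obtain ⟨z, hz, hzn⟩ := hex
    simp only [Set.mem_insert_iff, Set.mem_singleton_iff, not_or] at hzn
    obtain ⟨hza, hzb, hzc⟩ := hzn
    exact not_inTri_of_mem_hullVertices hS hgp hz (hVS ha) (hVS hb) (hVS hc)
      ⟨h1.2 z (hVS hz) hza hzb, h2.2 z (hVS hz) hzb hzc, h3.2 z (hVS hz) hzc hza⟩
  have hpair := exists_pair_of_two_to_one hVfin (hQ.subset (hullVertices_subset _)) e heU
    (by omega) (by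
      intro a ha b hb c hc hab hac hbc h1 h2
      rcases hadj' a ha b hb h1 hab with e1 | e1 <;>
      rcases hadj' a ha c hc h2 hac with e2 | e2 <;>
      rcases hadj' b hb c hc (h1.symm.trans h2) hbc with e3 | e3
      · exact hbc (e1.right_unique e2 (hVS hb) (hVS hc))
      · exact hbc (e1.right_unique e2 (hVS hb) (hVS hc))
      · exact hcycle a ha b hb c hc ⟨e1, e3, e2⟩
      · exact hac (e1.left_unique e3 (hVS ha) (hVS hc))
      · exact hab (e2.left_unique e3 (hVS ha) (hVS hb))
      · exact hcycle a ha c hc b hb ⟨e2, e3, e1⟩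
      · exact hbc (e1.left_unique e2 (hVS hb) (hVS hc))
      · exact hbc (e1.left_unique e2 (hVS hb) (hVS hc)))
  have hlr : ∀ u ∈ hullVertices (peel S), ∃ a ∈ hullVertices S, ∃ b ∈ hullVertices S,
      IsEdge S a b ∧ e a = u ∧ e b = u ∧ ∀ c ∈ hullVertices S, e c = u → c = a ∨ c = b := by
    intro u hu
    obtain ⟨a, ha, b, hb, hab, hau, hbu, hc⟩ := hpair u hu
    rcases hadj' a ha b hb (hau.trans hbu.symm) hab with h | h
    · exact ⟨a, ha, b, hb, h, hau, hbu, hc⟩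
    · exact ⟨b, hb, a, ha, h, hbu, hau, fun c hcV hcu => (hc c hcV hcu).symm⟩
  choose! l hl r hr hlre hel her hlr using hlr
  refine ⟨l, r, hl, hr, hlre, ?_, ?_, ?_⟩
  · intro u hu x hx hxl hxr
    have hl' := hl u hu
    have hr' := hr u hu
    have e1 : nx (l u) = r u := (hnxe _ hl').right_unique (hlre u hu) (hVS (hnx _ hl')) (hVS hr')
    have e2 : pv (r u) = l u := (hpve _ hr').left_unique (hlre u hu) (hVS (hpv _ hr')) (hVS hl')
    have t1 := heT _ hl'
    have t2 := heT _ hr'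
    have n1 := hpn _ hl'
    have n2 := hpn _ hr'
    rw [hel u hu, e1] at t1
    rw [her u hu, e2] at t2
    rw [e1] at n1
    rw [e2] at n2
    exact inTri_edge_of_mem_ears hS hgp (hVS (hpv _ hl')) (hVS hl') (hVS hr') (hVS (hnx _ hr'))
      (hpve _ hl') (hlre u hu) (hnxe _ hr') n1 n2 t1 t2 hx hxl hxr
  · intro u hu w hw huw
    refine ⟨fun h => huw ?_, fun h => huw ?_, fun h => huw ?_⟩
    · rw [← hel u hu, h, hel w hw]
    · rw [← hel u hu, h, her w hw]
    · rw [← her u hu, h, her w hw]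
  · intro v hv
    exact ⟨e v, heU v hv, hlr _ (heU v hv) v hv rfl⟩

/-! ### Orientations are forced by the next layer -/

/-- Labels `(q, s)` of the points of a set with next layer `Q`: the point `q` itself if `s = 0`,
and its two children if `s = ±1`. -/
def labels (Q : Set Plane) : Set (Plane × SignType) :=
  {x | x.1 ∈ Q ∧ (x.2 = 0 ∨ x.1 ∈ hullVertices Q)}

/-- The points `P u (±1)` are arranged around the vertices `u` of the hull of `Q` as the outermost
layer of a nested almost convex set is around the next layer. -/
structure IsSplit (Q : Set Plane) (P : Plane → SignType → Plane) : Prop where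
  zero : ∀ q, P q 0 = q
  sign_eq : ∀ x ∈ labels Q, ∀ y ∈ labels Q, ∀ z ∈ labels Q, x.1 ≠ y.1 → x.1 ≠ z.1 → y.1 ≠ z.1 →
    SignType.sign (det3 (P x.1 x.2) (P y.1 y.2) (P z.1 z.2)) = SignType.sign (det3 x.1 y.1 z.1)
  pair : ∀ u ∈ hullVertices Q, ∀ s t, s < t → ∀ y ∈ labels Q, y.1 ≠ u →
    0 < det3 (P u s) (P u t) (P y.1 y.2)
  triple : ∀ u ∈ hullVertices Q, 0 < det3 (P u (-1)) (P u 1) u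

/-- The family of points `l u`, `u`, `r u`. -/
def childPoint (l r : Plane → Plane) (u : Plane) : SignType → Plane
  | .zero => u
  | .neg => l u
  | .pos => r u

section

variable {S : Set Plane} {l r : Plane → Plane}

lemma IsChildren.childPoint_mem (h : IsChildren S l r) {x : Plane × SignType}
    (hx : x ∈ labels (peel S)) : childPoint l r x.1 x.2 ∈ S := by
  obtain ⟨u, s⟩ := x
  obtain ⟨hu, hs⟩ := hx
  rcases s with _ | _ | _
  · exact hu.1
  · exact hullVertices_subset S (h.left_mem u (hs.resolve_left nofun))
  · exact hullVertices_subset S (h.right_mem u (hs.resolve_left nofun))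

lemma IsChildren.childPoint_mem_hullVertices (h : IsChildren S l r) {u : Plane}
    (hu : u ∈ hullVertices (peel S)) {s : SignType} (hs : s ≠ 0) :
    childPoint l r u s ∈ hullVertices S := by
  rcases s with _ | _ | _
  · exact absurd rfl hs
  · exact h.left_mem u hu
  · exact h.right_mem u hu

lemma IsChildren.fst_eq (h : IsChildren S l r) {x y : Plane × SignType}
    (hx : x ∈ labels (peel S)) (hy : y ∈ labels (peel S))
    (hxy : childPoint l r x.1 x.2 = childPoint l r y.1 y.2) : x.1 = y.1 := by
  obtain ⟨u, s⟩ := x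
  obtain ⟨w, t⟩ := y
  by_contra hne
  simp only at hxy hne
  have key : ∀ (u w : Plane) (s t : SignType), (u, s) ∈ labels (peel S) →
      (w, t) ∈ labels (peel S) → s = 0 → t ≠ 0 → childPoint l r u s ≠ childPoint l r w t := by
    rintro u w s t hu hw rfl ht he
    refine hu.1.2 ?_
    change u = _ at he
    rw [he]
    exact h.childPoint_mem_hullVertices (hw.2.resolve_left ht) ht
  by_cases hs : s = 0 <;> by_cases ht : t = 0
  · subst hs ht; exact hne hxy
  · exact key u w s t hx hy hs ht hxy
  · exact key w u t s hy hx ht hs hxy.symm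
  · have hu := hx.2.resolve_left hs
    have hw := hy.2.resolve_left ht
    have d1 := h.disjoint u hu w hw hne
    have d2 := h.disjoint w hw u hu (Ne.symm hne)
    rcases s with _ | _ | _
    · exact hs rfl
    · rcases t with _ | _ | _
      · exact ht rfl
      · exact d1.1 hxy
      · exact d1.2.1 hxy
    · rcases t with _ | _ | _
      · exact ht rfl
      · exact d2.2.1 hxy.symm
      · exact d1.2.2 hxy

lemma IsChildren.eq_of_inTri (h : IsChildren S l r) (hS : S.Finite) (hgp : GeneralPosition S)
    (hT : OuterTriangles S) {u x z : Plane} (hu : u ∈ hullVertices (peel S))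
    (hx : x ∈ hullVertices S) (hxl : x ≠ l u) (hxr : x ≠ r u) (hz : z ∈ S)
    (hzT : InTri z (l u) (r u) x) : z = u := by
  by_cases hzV : z ∈ hullVertices S
  · exact absurd hzT (not_inTri_of_mem_hullVertices hS hgp hzV
      (hullVertices_subset S (h.left_mem u hu)) (hullVertices_subset S (h.right_mem u hu))
      (hullVertices_subset S hx))
  · exact (hT _ (h.left_mem u hu) _ (h.right_mem u hu) _ hx hzT.det_pos).unique
      ⟨⟨hz, hzV⟩, hzT⟩ ⟨hullVertices_subset _ hu, h.inTri u hu x hx hxl hxr⟩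

/-- If the line `x z` separated `l u` from `r u`, then either the hull vertex `x` would lie in the
triangle `l u, r u, z`, or `z` in the triangle `l u, r u, x`, whose only point is `u`. As `u` lies
in the latter triangle, it is on the same side as both children. -/
lemma IsChildren.same_side (h : IsChildren S l r) (hS : S.Finite) (hgp : GeneralPosition S)
    (hT : OuterTriangles S) {u x z : Plane} (hu : u ∈ hullVertices (peel S))
    (hx : x ∈ hullVertices S) (hxl : x ≠ l u) (hxr : x ≠ r u) (hz : z ∈ S) (hzu : z ≠ u)
    (hzl : z ≠ l u) (hzr : z ≠ r u) (hzx : z ≠ x) :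
    (0 < det3 (l u) x z ∧ 0 < det3 u x z ∧ 0 < det3 (r u) x z) ∨
      (det3 (l u) x z < 0 ∧ det3 u x z < 0 ∧ det3 (r u) x z < 0) := by
  have hlS := hullVertices_subset S (h.left_mem u hu)
  have hrS := hullVertices_subset S (h.right_mem u hu)
  have hxS := hullVertices_subset S hx
  have hlr := h.isEdge u hu
  have huT := h.inTri u hu x hx hxl hxr
  rcases hgp.pos_or_neg hlS hxS hz hxl.symm hzl.symm hzx.symm with h1 | h1 <;>
    rcases hgp.pos_or_neg hrS hxS hz hxr.symm hzr.symm hzx.symm with h2 | h2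
  · refine Or.inl ⟨h1, ?_, h2⟩
    rw [← det3_rot] at h1 h2 ⊢
    exact huT.pos h1.le h2.le (by rw [det3_self']) (Or.inl h1)
  · refine absurd ⟨hlr.2 x hxS hxl hxr, ?_, ?_⟩
      (not_inTri_of_mem_hullVertices hS hgp hx hlS hrS hz)
    · rw [det3_swap']; linarith
    · rwa [← det3_rot]
  · refine absurd (h.eq_of_inTri hS hgp hT hu hx hxl hxr hz ⟨hlr.2 z hz hzl hzr, h2, ?_⟩) hzu
    rw [det3_swap]; linarith
  · refine Or.inr ⟨h1, ?_, h2⟩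
    rw [← det3_rot] at h1 h2 ⊢
    exact huT.neg h1.le h2.le (by rw [det3_self']) (Or.inl h1)

/-- If `z` were to the right of the line from `l u` to `u`, then with `x` the hull successor of `r
u` the hull vertex `l u` would lie in the triangle `u x z`. The other half is the mirror image, with
the predecessor of `l u`. -/
lemma IsChildren.pos_of_not_mem (h : IsChildren S l r) (hS : S.Finite) (hgp : GeneralPosition S)
    (hT : OuterTriangles S) {u z : Plane} (hu : u ∈ hullVertices (peel S)) (hz : z ∈ S)
    (hzu : z ≠ u) (hzl : z ≠ l u) (hzr : z ≠ r u) :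
    0 < det3 (l u) u z ∧ 0 < det3 u (r u) z := by
  have hl := h.left_mem u hu
  have hr := h.right_mem u hu
  have hlS := hullVertices_subset S hl
  have hrS := hullVertices_subset S hr
  have huQ := hullVertices_subset _ hu
  have hul : u ≠ l u := fun he => huQ.2 (by rw [he]; exact hl)
  have hur : u ≠ r u := fun he => huQ.2 (by rw [he]; exact hr)
  have hlr := h.isEdge u hu
  have hnt : S.Nontrivial := ⟨_, hlS, _, hrS, hlr.1⟩
  have hlrz := hlr.2 z hz hzl hzr
  constructor
  · refine (hgp.pos_or_neg hlS huQ.1 hz hul.symm hzl.symm hzu.symm).resolve_right fun hneg => ?_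
    obtain ⟨x, hx, hrx⟩ := exists_isEdge_left hS hgp hnt hr
    have hxl : x ≠ l u := by
      intro he
      have := hrx.2 z hz hzr (by rw [he]; exact hzl)
      rw [he, det3_swap] at this; linarith
    have huT := h.inTri u hu x hx hxl hrx.1.symm
    have hlux : 0 < det3 (l u) u x := by rw [← det3_rot, ← det3_rot]; exact huT.2.2
    by_cases hzx : z = x
    · rw [hzx] at hneg; linarith
    have hrxz := hrx.2 z hz hzr hzx
    rcases h.same_side hS hgp hT hu hx hxl hrx.1.symm hz hzu hzl hzr hzx with hs | hs
    · refine not_inTri_of_mem_hullVertices hS hgp hl huQ.1 (hullVertices_subset S hx) hz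
        ⟨?_, ?_, ?_⟩
      · rwa [det3_rot]
      · rw [det3_rot]; exact hs.1
      · linarith [det3_swap' (l u) u z, det3_rot (l u) z u]
    · linarith [hs.2.2]
  · refine (hgp.pos_or_neg huQ.1 hrS hz hur hzu.symm hzr.symm).resolve_right fun hneg => ?_
    obtain ⟨x, hx, hxl⟩ := exists_isEdge_right hS hgp hnt hl
    have hxr : x ≠ r u := by
      intro he
      have := hxl.2 z hz (by rw [he]; exact hzr) hzl
      rw [he, det3_swap] at this; linarith
    have huT := h.inTri u hu x hx hxl.1 hxr
    have hurx : 0 < det3 u (r u) x := by rw [← det3_rot]; exact huT.2.1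
    by_cases hzx : z = x
    · rw [hzx] at hneg; linarith
    have hlxz := hxl.2 z hz hzx hzl
    rw [det3_swap] at hlxz
    rcases h.same_side hS hgp hT hu hx hxl.1 hxr hz hzu hzl hzr hzx with hs | hs
    · linarith [hs.1]
    · refine not_inTri_of_mem_hullVertices hS hgp hr (hullVertices_subset S hx) huQ.1 hz
        ⟨?_, ?_, ?_⟩
      · rwa [← det3_rot]
      · rw [det3_swap']; linarith
      · linarith [det3_swap' (r u) x z, det3_rot (r u) z x, hs.2.2]

lemma IsChildren.ne_of_fst_ne (h : IsChildren S l r) {u : Plane}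
    (hu : u ∈ hullVertices (peel S)) {y : Plane × SignType} (hy : y ∈ labels (peel S))
    (hne : y.1 ≠ u) : childPoint l r y.1 y.2 ≠ u ∧ childPoint l r y.1 y.2 ≠ l u ∧
      childPoint l r y.1 y.2 ≠ r u := by
  have hu' := hullVertices_subset _ hu
  exact ⟨fun he => hne (h.fst_eq hy (y := (u, 0)) ⟨hu', Or.inl rfl⟩ he),
    fun he => hne (h.fst_eq hy (y := (u, .neg)) ⟨hu', Or.inr hu⟩ he),
    fun he => hne (h.fst_eq hy (y := (u, .pos)) ⟨hu', Or.inr hu⟩ he)⟩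

lemma IsChildren.sign_left (h : IsChildren S l r) (hS : S.Finite) (hgp : GeneralPosition S)
    (hT : OuterTriangles S) {u x z : Plane} (hu : u ∈ hullVertices (peel S))
    (hx : x ∈ hullVertices S) (hxl : x ≠ l u) (hxr : x ≠ r u) (hz : z ∈ S) (hzu : z ≠ u)
    (hzl : z ≠ l u) (hzr : z ≠ r u) (hzx : z ≠ x) (s : SignType) :
    SignType.sign (det3 (childPoint l r u s) x z) = SignType.sign (det3 u x z) := by
  rcases h.same_side hS hgp hT hu hx hxl hxr hz hzu hzl hzr hzx with ⟨h1, h2, h3⟩ | ⟨h1, h2, h3⟩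
  · rw [sign_pos h2]
    rcases s with _ | _ | _
    exacts [sign_pos h2, sign_pos h1, sign_pos h3]
  · rw [sign_neg h2]
    rcases s with _ | _ | _
    exacts [sign_neg h2, sign_neg h1, sign_neg h3]

lemma sign_det3_swap (a b c : Plane) :
    SignType.sign (det3 b a c) = -SignType.sign (det3 a b c) := by
  rw [det3_swap, Left.sign_neg]

/-- For fixed `p` consider the 3 by 3 table of signs indexed by `s` and `t`. `sign_left` makes every
row with `s ≠ 0` and every column with `t ≠ 0` constant, which links all entries except the one for
the two parents; `hbase` supplies that one. -/
lemma IsChildren.sign_pair (h : IsChildren S l r) (hS : S.Finite) (hgp : GeneralPosition S)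
    (hT : OuterTriangles S) {x y z : Plane × SignType}
    (hx : x ∈ labels (peel S)) (hy : y ∈ labels (peel S)) (hz : z ∈ labels (peel S))
    (hxU : x.1 ∈ hullVertices (peel S)) (hyU : y.1 ∈ hullVertices (peel S))
    (hxy : x.1 ≠ y.1) (hxz : x.1 ≠ z.1) (hyz : y.1 ≠ z.1) :
    SignType.sign (det3 (childPoint l r x.1 x.2) (childPoint l r y.1 y.2)
      (childPoint l r z.1 z.2)) = SignType.sign (det3 x.1 y.1 (childPoint l r z.1 z.2)) := by
  obtain ⟨u, s⟩ := x
  obtain ⟨w, t⟩ := y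
  set p := childPoint l r z.1 z.2 with hp
  simp only at *
  have hpS : p ∈ S := h.childPoint_mem hz
  have hpu := h.ne_of_fst_ne hxU hz (Ne.symm hxz)
  have hpw := h.ne_of_fst_ne hyU hz (Ne.symm hyz)
  rw [← hp] at hpu hpw
  have hmem : ∀ (u) (s : SignType), u ∈ hullVertices (peel S) → (u, s) ∈ labels (peel S) :=
    fun u s hu => ⟨hullVertices_subset _ hu, Or.inr hu⟩
  have hzne : ∀ (u) (s : SignType), u ∈ hullVertices (peel S) → u ≠ z.1 →
      p ≠ childPoint l r u s := fun u s hu hne he =>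
    hne (h.fst_eq (x := z) (y := (u, s)) hz (hmem u s hu) he).symm
  have hrow : ∀ s t, t ≠ 0 → SignType.sign (det3 (childPoint l r u s) (childPoint l r w t) p) =
      SignType.sign (det3 u (childPoint l r w t) p) := by
    intro s t ht
    have hne := h.ne_of_fst_ne hxU (hmem w t hyU) (Ne.symm hxy)
    exact h.sign_left hS hgp hT hxU (h.childPoint_mem_hullVertices hyU ht) hne.2.1 hne.2.2 hpS
      hpu.1 hpu.2.1 hpu.2.2 (hzne w t hyU hyz) s
  have hcol : ∀ s t, s ≠ 0 → SignType.sign (det3 (childPoint l r u s) (childPoint l r w t) p) =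
      SignType.sign (det3 (childPoint l r u s) w p) := by
    intro s t hs
    have hne := h.ne_of_fst_ne hyU (hmem u s hxU) hxy
    rw [sign_det3_swap, sign_det3_swap w]
    congr 1
    exact h.sign_left hS hgp hT hyU (h.childPoint_mem_hullVertices hxU hs) hne.2.1 hne.2.2 hpS
      hpw.1 hpw.2.1 hpw.2.2 (hzne u s hxU hxz) t
  have hone : (1 : SignType) ≠ 0 := by decide
  have hneg : (-1 : SignType) ≠ 0 := by decide
  have e1 : SignType.sign (det3 u (l w) p) = SignType.sign (det3 u (r w) p) := by
    have a1 := hrow 1 (-1) hneg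
    have a2 := hrow 1 1 hone
    have a3 := hcol 1 (-1) hone
    have a4 := hcol 1 1 hone
    exact a1.symm.trans (a3.trans (a4.symm.trans a2))
  -- The children of `u` lie on opposite sides of the line `u p`, and those of `w` on a common side.
  -- The point `w` is in the triangle of its own children with either child of `u`; the child of `u`
  -- on the common side settles the sign.
  have hbase : SignType.sign (det3 u w p) = SignType.sign (det3 u (r w) p) := by
    have hlu := h.left_mem u hxU
    have hru := h.right_mem u hxU
    have d := h.disjoint u hxU w hyU hxy
    have d' := h.disjoint w hyU u hxU (Ne.symm hxy)
    have t1 := h.inTri w hyU (l u) hlu d.1 d.2.1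
    have t2 := h.inTri w hyU (r u) hru d'.2.1.symm d.2.2
    obtain ⟨q1, q2⟩ := h.pos_of_not_mem hS hgp hT hxU hpS hpu.1 hpu.2.1 hpu.2.2
    rw [det3_swap] at q1
    rcases hgp.pos_or_neg (hullVertices_subset _ hxU).1
      (hullVertices_subset S (h.right_mem w hyU)) hpS
      (fun he => (hullVertices_subset _ hxU).2 (he ▸ h.right_mem w hyU)) hpu.1.symm
      hpw.2.2.symm with hs | hs
    · rw [sign_pos hs, sign_eq_one_iff] at e1
      rw [sign_pos hs, sign_eq_one_iff]
      rw [← det3_rot, ← det3_rot] at hs e1 q2 ⊢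
      exact t2.pos e1.le hs.le q2.le (Or.inl e1)
    · rw [sign_neg hs, sign_eq_neg_one_iff] at e1
      rw [sign_neg hs, sign_eq_neg_one_iff]
      have q1' : det3 u (l u) p < 0 := by linarith
      rw [← det3_rot, ← det3_rot] at hs e1 q1' ⊢
      exact t1.neg e1.le hs.le q1'.le (Or.inl e1)
  have hu0 : ∀ t, t ≠ 0 → SignType.sign (det3 u (childPoint l r w t) p) =
      SignType.sign (det3 u (r w) p) := by
    intro t ht
    rcases t with _ | _ | _
    exacts [absurd rfl ht, e1, rfl]
  rw [hbase]
  by_cases ht : t = 0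
  · by_cases hs : s = 0
    · subst hs ht; exact hbase
    · rw [hcol s t hs, ← hcol s 1 hs, hrow s 1 hone]; rfl
  · rw [hrow s t ht, hu0 t ht]

/-- Some hull vertex `w` of `peel S` lies angularly between `q` and `q'` as seen from `u`. By
`sign_pair` it does so as seen from the child too, and `det3_trans` at both points gives the same
order of `q` and `q'`. -/
lemma IsChildren.sign_single (h : IsChildren S l r) (hS : S.Finite) (hgp : GeneralPosition S)
    (hT : OuterTriangles S) (hT' : OuterTriangles (peel S)) {x : Plane × SignType} {q q' : Plane}
    (hx : x ∈ labels (peel S)) (hq : q ∈ peel (peel S)) (hq' : q' ∈ peel (peel S)) :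
    SignType.sign (det3 (childPoint l r x.1 x.2) q q') = SignType.sign (det3 x.1 q q') := by
  obtain ⟨u, s⟩ := x
  simp only
  by_cases hs : s = 0
  · subst hs; rfl
  have hu : u ∈ hullVertices (peel S) := hx.2.resolve_left hs
  have huQ := hullVertices_subset _ hu
  have hQ := hS.subset (peel_subset S)
  have hgpQ := hgp.mono (peel_subset S)
  have hV := h.childPoint_mem_hullVertices hu hs
  have key : ∀ q ∈ peel (peel S), ∀ q' ∈ peel (peel S), ∀ w ∈ hullVertices (peel S), w ≠ u →
      0 < det3 u w q → det3 u w q' < 0 → 0 < det3 (childPoint l r u s) q' q ∧ 0 < det3 u q' q := by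
    intro q hq q' hq' w hw hwu h1 h2
    have hwQ := hullVertices_subset _ hw
    have hsgn : ∀ q ∈ peel (peel S), SignType.sign (det3 (childPoint l r u s) w q) =
        SignType.sign (det3 u w q) := by
      intro q hq
      exact h.sign_pair hS hgp hT (x := (u, s)) (y := (w, 0)) (z := (q, 0)) hx ⟨hwQ, Or.inl rfl⟩
        ⟨hq.1, Or.inl rfl⟩ hu hw hwu.symm (fun he : u = q => hq.2 (he ▸ hu)) (fun he : w = q => hq.2 (he ▸ hw))
    have h1' := hsgn q hq
    have h2' := hsgn q' hq'
    rw [sign_pos h1, sign_eq_one_iff] at h1'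
    rw [sign_neg h2, sign_eq_neg_one_iff] at h2'
    refine ⟨det3_trans hS hgp hV hq'.1.1 hwQ.1 hq.1.1 ?_ h1',
      det3_trans hQ hgpQ hu hq'.1 hwQ hq.1 ?_ h1⟩
    · rw [det3_swap']; linarith
    · rw [det3_swap']; linarith
  by_cases hne : q = q'
  · subst hne; rw [det3_self, det3_self]
  obtain ⟨w, hw, hwu, ⟨h1, h2⟩ | ⟨h1, h2⟩⟩ := exists_separating_vertex hQ hgpQ hT' hu hq hq' hne
  · obtain ⟨k1, k2⟩ := key q hq q' hq' w hw hwu h1 h2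
    rw [det3_swap'] at k1 k2
    rw [sign_neg (by linarith), sign_neg (by linarith)]
  · obtain ⟨k1, k2⟩ := key q' hq' q hq w hw hwu h2 h1
    rw [sign_pos k1, sign_pos k2]

/-- If two of the three parents are hull vertices, `sign_pair` is used, a second time when the third
point is a child as well; otherwise two points are inner and `sign_single` applies. -/
lemma IsChildren.isSplit (h : IsChildren S l r) (hS : S.Finite) (hgp : GeneralPosition S)
    (hT : OuterTriangles S) (hT' : OuterTriangles (peel S)) :
    IsSplit (peel S) (childPoint l r) := by
  have two : ∀ x ∈ labels (peel S), ∀ y ∈ labels (peel S), ∀ z ∈ labels (peel S),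
      x.1 ≠ y.1 → x.1 ≠ z.1 → y.1 ≠ z.1 → x.1 ∈ hullVertices (peel S) →
      y.1 ∈ hullVertices (peel S) →
      SignType.sign (det3 (childPoint l r x.1 x.2) (childPoint l r y.1 y.2)
        (childPoint l r z.1 z.2)) = SignType.sign (det3 x.1 y.1 z.1) := by
    intro x hx y hy z hz hxy hxz hyz hxU hyU
    rw [h.sign_pair hS hgp hT hx hy hz hxU hyU hxy hxz hyz]
    by_cases hz0 : z.2 = 0
    · rw [hz0]; rfl
    have hzU := hz.2.resolve_left hz0
    have := h.sign_pair hS hgp hT (x := (y.1, 0)) (y := z) (z := (x.1, 0)) ⟨hy.1, Or.inl rfl⟩ hz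
      ⟨hx.1, Or.inl rfl⟩ hyU hzU hyz (Ne.symm hxy) (Ne.symm hxz)
    rw [← det3_rot x.1, ← det3_rot x.1 y.1 z.1]
    exact this
  have one : ∀ x ∈ labels (peel S), ∀ y ∈ labels (peel S), ∀ z ∈ labels (peel S),
      y.1 ∉ hullVertices (peel S) → z.1 ∉ hullVertices (peel S) →
      SignType.sign (det3 (childPoint l r x.1 x.2) (childPoint l r y.1 y.2)
        (childPoint l r z.1 z.2)) = SignType.sign (det3 x.1 y.1 z.1) := by
    intro x hx y hy z hz hyU hzU
    rw [hy.2.resolve_right hyU, hz.2.resolve_right hzU]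
    exact h.sign_single hS hgp hT hT' hx ⟨hy.1, hyU⟩ ⟨hz.1, hzU⟩
  refine ⟨fun q => rfl, ?_, ?_, ?_⟩
  · intro x hx y hy z hz hxy hxz hyz
    by_cases hxU : x.1 ∈ hullVertices (peel S) <;> by_cases hyU : y.1 ∈ hullVertices (peel S)
    · exact two x hx y hy z hz hxy hxz hyz hxU hyU
    · by_cases hzU : z.1 ∈ hullVertices (peel S)
      · have := two z hz x hx y hy hxz.symm hyz.symm hxy hzU hxU
        rwa [← det3_rot, ← det3_rot z.1] at this
      · exact one x hx y hy z hz hyU hzU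
    · by_cases hzU : z.1 ∈ hullVertices (peel S)
      · have := two y hy z hz x hx hyz hxy.symm hxz.symm hyU hzU
        rwa [det3_rot, det3_rot x.1] at this
      · have := one y hy z hz x hx hzU hxU
        rwa [det3_rot, det3_rot x.1] at this
    · have := one z hz x hx y hy hxU hyU
      rwa [← det3_rot, ← det3_rot z.1] at this
  · intro u hu s t hst y hy hyu
    have hyS := h.childPoint_mem hy
    obtain ⟨n1, n2, n3⟩ := h.ne_of_fst_ne hu hy hyu
    obtain ⟨p1, p2⟩ := h.pos_of_not_mem hS hgp hT hu hyS n1 n2 n3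
    rcases s with _ | _ | _ <;> rcases t with _ | _ | _
    · exact absurd hst (by decide)
    · exact absurd hst (by decide)
    · exact p2
    · exact p1
    · exact absurd hst (by decide)
    · exact (h.isEdge u hu).2 _ hyS n2 n3
    · exact absurd hst (by decide)
    · exact absurd hst (by decide)
    · exact absurd hst (by decide)
  · intro u hu
    have huQ := hullVertices_subset _ hu
    exact (h.isEdge u hu).2 u huQ.1 (fun he => huQ.2 (he ▸ h.left_mem u hu))
      (fun he => huQ.2 (he ▸ h.right_mem u hu))

lemma IsChildren.image_labels (h : IsChildren S l r) :
    (fun x : Plane × SignType => childPoint l r x.1 x.2) '' labels (peel S) = S := by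
  apply subset_antisymm
  · rintro _ ⟨x, hx, rfl⟩
    exact h.childPoint_mem hx
  · intro v hv
    by_cases hvV : v ∈ hullVertices S
    · obtain ⟨u, hu, rfl | rfl⟩ := h.surj v hvV
      · exact ⟨(u, -1), ⟨hullVertices_subset _ hu, Or.inr hu⟩, rfl⟩
      · exact ⟨(u, 1), ⟨hullVertices_subset _ hu, Or.inr hu⟩, rfl⟩
    · exact ⟨(v, 0), ⟨⟨hv, hvV⟩, Or.inl rfl⟩, rfl⟩

end

/-! ### Uniqueness of the order type -/

lemma sign_det3_eq_of_lt {ι : Type*} [LinearOrder ι] {g g' : ι → Plane}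
    (h : ∀ i j k, i < j → j < k →
      SignType.sign (det3 (g' i) (g' j) (g' k)) = SignType.sign (det3 (g i) (g j) (g k)))
    (i j k : ι) :
    SignType.sign (det3 (g' i) (g' j) (g' k)) = SignType.sign (det3 (g i) (g j) (g k)) := by
  have hrot : ∀ i j k, i < j → j < k →
      SignType.sign (det3 (g' j) (g' k) (g' i)) = SignType.sign (det3 (g j) (g k) (g i)) := by
    intro i j k h1 h2
    rw [det3_rot, det3_rot (g i)]; exact h i j k h1 h2
  have hrot' : ∀ i j k, i < j → j < k →
      SignType.sign (det3 (g' k) (g' i) (g' j)) = SignType.sign (det3 (g k) (g i) (g j)) := by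
    intro i j k h1 h2
    rw [← det3_rot, ← det3_rot (g k)]; exact h i j k h1 h2
  have hself : ∀ i j k, i = j ∨ j = k ∨ i = k →
      SignType.sign (det3 (g' i) (g' j) (g' k)) = SignType.sign (det3 (g i) (g j) (g k)) := by
    rintro i j k (rfl | rfl | rfl) <;> simp [det3_self, det3_self', det3_self'']
  have hswap : ∀ i j k,
      SignType.sign (det3 (g' i) (g' j) (g' k)) = SignType.sign (det3 (g i) (g j) (g k)) →
      SignType.sign (det3 (g' j) (g' i) (g' k)) = SignType.sign (det3 (g j) (g i) (g k)) := by
    intro i j k e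
    rw [sign_det3_swap, e, ← sign_det3_swap]
  rcases lt_trichotomy i j with h1 | h1 | h1
  · rcases lt_trichotomy j k with h2 | h2 | h2
    · exact h i j k h1 h2
    · exact hself _ _ _ (Or.inr (Or.inl h2))
    · rcases lt_trichotomy i k with h3 | h3 | h3
      · exact hswap _ _ _ (hrot' i k j h3 h2)
      · exact hself _ _ _ (Or.inr (Or.inr h3))
      · exact hrot k i j h3 h1
  · exact hself _ _ _ (Or.inl h1)
  · rcases lt_trichotomy j k with h2 | h2 | h2
    · rcases lt_trichotomy i k with h3 | h3 | h3
      · exact hswap _ _ _ (h j i k h1 h3)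
      · exact hself _ _ _ (Or.inr (Or.inr h3))
      · exact hrot' j k i h2 h3
    · exact hself _ _ _ (Or.inr (Or.inl h2))
    · exact hswap _ _ _ (hrot k j i h2 h1)

/-- Points with a nonzero determinant are distinct, and the positivity rules place any two labelled
points with a common parent, or with a hull vertex among the parents, in such a triple. -/
lemma IsSplit.injOn {Q : Set Plane} {P : Plane → SignType → Plane} (h : IsSplit Q P) :
    Set.InjOn (fun x : Plane × SignType => P x.1 x.2) (labels Q) := by
  have key : ∀ x ∈ labels Q, ∀ y ∈ labels Q, x.1 ≠ y.1 → x.1 ∈ hullVertices Q →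
      P x.1 x.2 ≠ P y.1 y.2 := by
    intro x hx y hy hne hxU he
    obtain ⟨t, ht⟩ := exists_ne x.2
    rcases lt_or_gt_of_ne ht with h1 | h1
    · exact (ne_of_det3_pos (h.pair x.1 hxU _ _ h1 y hy hne.symm)).2.2 he
    · exact (ne_of_det3_pos (h.pair x.1 hxU _ _ h1 y hy hne.symm)).2.1 he
  rintro x hx y hy hxy
  simp only at hxy
  have hfst : x.1 = y.1 := by
    by_contra hne
    by_cases hxU : x.1 ∈ hullVertices Q
    · exact key x hx y hy hne hxU hxy
    by_cases hyU : y.1 ∈ hullVertices Q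
    · exact key y hy x hx (Ne.symm hne) hyU hxy.symm
    rw [hx.2.resolve_right hxU, hy.2.resolve_right hyU, h.zero, h.zero] at hxy
    exact hne hxy
  by_contra hne
  obtain ⟨u, s⟩ := x
  obtain ⟨w, t⟩ := y
  simp only at hfst
  subst hfst
  have hst : s ≠ t := fun he => hne (by rw [he])
  have hu : u ∈ hullVertices Q := by
    by_contra hu
    exact hst ((hx.2.resolve_right hu).trans (hy.2.resolve_right hu).symm)
  have h3 := ne_of_det3_pos (h.triple u hu)
  rw [← h.zero u] at h3
  simp only [h.zero] at hxy h3
  rcases s with _ | _ | _ <;> rcases t with _ | _ | _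
  · exact hst rfl
  · exact h3.2.1 ((h.zero u).symm.trans hxy).symm
  · exact h3.2.2 ((h.zero u).symm.trans hxy).symm
  · exact h3.2.1 (hxy.trans (h.zero u))
  · exact hst rfl
  · exact h3.1 hxy
  · exact h3.2.2 (hxy.trans (h.zero u))
  · exact h3.1 hxy.symm
  · exact hst rfl

/-- `f` restricts to a bijection from `S` to `T` that preserves all orientations. -/
def PreservesOrderType (f : Plane → Plane) (S T : Set Plane) : Prop :=
  Set.BijOn f S T ∧ ∀ a ∈ S, ∀ b ∈ S, ∀ c ∈ S,
    SignType.sign (det3 (f a) (f b) (f c)) = SignType.sign (det3 a b c)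

lemma PreservesOrderType.pos_iff {f : Plane → Plane} {S T : Set Plane}
    (h : PreservesOrderType f S T) {a b c : Plane} (ha : a ∈ S) (hb : b ∈ S) (hc : c ∈ S) :
    0 < det3 (f a) (f b) (f c) ↔ 0 < det3 a b c := by
  rw [← sign_eq_one_iff, ← sign_eq_one_iff, h.2 a ha b hb c hc]

lemma PreservesOrderType.inTri_iff {f : Plane → Plane} {S T : Set Plane}
    (h : PreservesOrderType f S T) {p a b c : Plane} (hp : p ∈ S) (ha : a ∈ S) (hb : b ∈ S)
    (hc : c ∈ S) : InTri (f p) (f a) (f b) (f c) ↔ InTri p a b c := by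
  unfold InTri
  rw [h.pos_iff ha hb hp, h.pos_iff hb hc hp, h.pos_iff hc ha hp]

lemma PreservesOrderType.mem_hullVertices_iff {f : Plane → Plane} {S T : Set Plane}
    (h : PreservesOrderType f S T) (hS : S.Finite) (hgp : GeneralPosition S) (hT : T.Finite)
    (hgpT : GeneralPosition T) {p : Plane} (hp : p ∈ S) :
    f p ∈ hullVertices T ↔ p ∈ hullVertices S := by
  rw [_root_.mem_hullVertices_iff hS hgp, _root_.mem_hullVertices_iff hT hgpT]
  constructor
  · rintro ⟨-, hf⟩
    refine ⟨hp, fun a ha b hb c hc hT => hf _ (h.1.mapsTo ha) _ (h.1.mapsTo hb) _ (h.1.mapsTo hc) ?_⟩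
    exact (h.inTri_iff hp ha hb hc).2 hT
  · rintro ⟨-, hf⟩
    refine ⟨h.1.mapsTo hp, fun a ha b hb c hc hT => ?_⟩
    obtain ⟨a, haS, rfl⟩ := h.1.surjOn ha
    obtain ⟨b, hbS, rfl⟩ := h.1.surjOn hb
    obtain ⟨c, hcS, rfl⟩ := h.1.surjOn hc
    exact hf a haS b hbS c hcS ((h.inTri_iff hp haS hbS hcS).1 hT)

/-- The rules of `IsSplit` cover three, two or one distinct parents, so an orientation depends only
on the labels and on the orientations in `Q`. -/
lemma IsSplit.sign_det3_eq {Q Q' : Set Plane} {P P' : Plane → SignType → Plane}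
    (h : IsSplit Q P) (h' : IsSplit Q' P') {f : Plane → Plane} (hf : PreservesOrderType f Q Q')
    (hfU : ∀ q ∈ Q, (f q ∈ hullVertices Q' ↔ q ∈ hullVertices Q)) {x y z : Plane × SignType}
    (hx : x ∈ labels Q) (hy : y ∈ labels Q) (hz : z ∈ labels Q) :
    SignType.sign (det3 (P' (f x.1) x.2) (P' (f y.1) y.2) (P' (f z.1) z.2)) =
      SignType.sign (det3 (P x.1 x.2) (P y.1 y.2) (P z.1 z.2)) := by
  have hlab : ∀ x ∈ labels Q, (f x.1, x.2) ∈ labels Q' := fun x hx =>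
    ⟨hf.1.mapsTo hx.1, hx.2.imp id (hfU _ hx.1).2⟩
  have hlt : ∀ u ∈ Q, ∀ s t : SignType, s < t → (s = 0 ∨ u ∈ hullVertices Q) →
      (t = 0 ∨ u ∈ hullVertices Q) → u ∈ hullVertices Q := by
    rintro u - s t hst (hs | hs) (ht | ht)
    · exact absurd (hs.trans ht.symm) hst.ne
    all_goals assumption
  have pair : ∀ x ∈ labels Q, ∀ y ∈ labels Q, ∀ z ∈ labels Q, x.1 = y.1 → x.1 ≠ z.1 →
      SignType.sign (det3 (P' (f x.1) x.2) (P' (f y.1) y.2) (P' (f z.1) z.2)) =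
        SignType.sign (det3 (P x.1 x.2) (P y.1 y.2) (P z.1 z.2)) := by
    rintro ⟨u, s⟩ hx ⟨w, t⟩ hy z hz hxy hxz
    simp only at hxy hxz ⊢
    subst hxy
    have hfne : f z.1 ≠ f u := fun he => hxz (hf.1.injOn hx.1 hz.1 he.symm)
    rcases lt_trichotomy s t with hst | rfl | hst
    · have hu := hlt u hx.1 s t hst hx.2 hy.2
      rw [sign_pos (h.pair u hu s t hst z hz hxz.symm),
        sign_pos (h'.pair (f u) ((hfU u hx.1).2 hu) s t hst _ (hlab z hz) hfne)]
    · simp [det3_self'']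
    · have hu := hlt u hx.1 t s hst hy.2 hx.2
      rw [sign_det3_swap, sign_det3_swap (P u t), sign_pos (h.pair u hu t s hst z hz hxz.symm),
        sign_pos (h'.pair (f u) ((hfU u hx.1).2 hu) t s hst _ (hlab z hz) hfne)]
  by_cases hxy : x.1 = y.1
  · by_cases hxz : x.1 = z.1
    · obtain ⟨u, s⟩ := x
      obtain ⟨v, t⟩ := y
      obtain ⟨w, s'⟩ := z
      simp only at hxy hxz ⊢
      subst hxy hxz
      by_cases hu : u ∈ hullVertices Q
      · refine sign_det3_eq_of_lt (g := P u) (g' := P' (f u)) ?_ s t s'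
        intro i j k hij hjk
        have h1 := h.triple u hu
        have h2 := h'.triple (f u) ((hfU u hx.1).2 hu)
        rw [← h.zero u, det3_swap', h.zero u] at h1
        rw [← h'.zero (f u), det3_swap', h'.zero (f u)] at h2
        have hi : i = -1 := by revert i j k; decide
        have hj : j = 0 := by revert i j k; decide
        have hk : k = 1 := by revert i j k; decide
        subst hi hj hk
        rw [sign_neg (by simpa only [h'.zero] using neg_pos.1 h2),
          sign_neg (by simpa only [h.zero] using neg_pos.1 h1)]
      · obtain rfl : s = 0 := hx.2.resolve_right hu
        obtain rfl : t = 0 := hy.2.resolve_right hu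
        simp [det3_self'']
    · exact pair x hx y hy z hz hxy hxz
  · by_cases hxz : x.1 = z.1
    · have := pair z hz x hx y hy hxz.symm (fun he => hxy (hxz.trans he))
      rwa [← det3_rot, ← det3_rot (P z.1 z.2)] at this
    · by_cases hyz : y.1 = z.1
      · have := pair y hy z hz x hx hyz (Ne.symm hxy)
        rwa [det3_rot, det3_rot (P x.1 x.2)] at this
      · rw [h.sign_eq x hx y hy z hz hxy hxz hyz, h'.sign_eq _ (hlab x hx) _ (hlab y hy) _
          (hlab z hz) (fun he => hxy (hf.1.injOn hx.1 hy.1 he))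
          (fun he => hxz (hf.1.injOn hx.1 hz.1 he)) (fun he => hyz (hf.1.injOn hy.1 hz.1 he))]
        exact hf.2 _ hx.1 _ hy.1 _ hz.1

/-- A correspondence of orientations along labellings gives an orientation preserving bijection. -/
lemma exists_preservesOrderType_of_labelling {ι : Type*} {I : Set ι} {S T : Set Plane}
    {g g' : ι → Plane} (hg : Set.BijOn g I S) (hg' : Set.BijOn g' I T)
    (h : ∀ i ∈ I, ∀ j ∈ I, ∀ k ∈ I,
      SignType.sign (det3 (g' i) (g' j) (g' k)) = SignType.sign (det3 (g i) (g j) (g k))) :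
    ∃ f, PreservesOrderType f S T := by
  rcases I.eq_empty_or_nonempty with rfl | ⟨i₀, -⟩
  · obtain rfl : S = ∅ := by simpa using hg.image_eq.symm
    obtain rfl : T = ∅ := by simpa using hg'.image_eq.symm
    exact ⟨id, Set.bijOn_empty _, by simp⟩
  have : Nonempty ι := ⟨i₀⟩
  have hinv := hg.invOn_invFunOn
  have hinvbij : Set.BijOn (Function.invFunOn g I) S I := Set.BijOn.symm hinv.symm hg
  refine ⟨g' ∘ Function.invFunOn g I, hg'.comp hinvbij, fun a ha b hb c hc => ?_⟩
  have := h _ (hinvbij.mapsTo ha) _ (hinvbij.mapsTo hb) _ (hinvbij.mapsTo hc)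
  rwa [hinv.2 ha, hinv.2 hb, hinv.2 hc] at this

lemma exists_preservesOrderType_of_isSplit {S S' : Set Plane} {l r l' r' : Plane → Plane}
    (hS : S.Finite) (hgp : GeneralPosition S) (hT : OuterTriangles S)
    (hT1 : OuterTriangles (peel S)) (hS' : S'.Finite) (hgp' : GeneralPosition S')
    (hT' : OuterTriangles S') (hT1' : OuterTriangles (peel S')) (hc : IsChildren S l r)
    (hc' : IsChildren S' l' r') {f : Plane → Plane}
    (hf : PreservesOrderType f (peel S) (peel S')) : ∃ g, PreservesOrderType g S S' := by
  have hsp := hc.isSplit hS hgp hT hT1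
  have hsp' := hc'.isSplit hS' hgp' hT' hT1'
  have hfU : ∀ q ∈ peel S, (f q ∈ hullVertices (peel S') ↔ q ∈ hullVertices (peel S)) :=
    fun q hq => hf.mem_hullVertices_iff (hS.subset (peel_subset S)) (hgp.mono (peel_subset S))
      (hS'.subset (peel_subset S')) (hgp'.mono (peel_subset S')) hq
  have hlabbij : Set.BijOn (fun x : Plane × SignType => (f x.1, x.2)) (labels (peel S))
      (labels (peel S')) := by
    refine ⟨fun x hx => ⟨hf.1.mapsTo hx.1, hx.2.imp id (hfU _ hx.1).2⟩, ?_, ?_⟩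
    · intro x hx y hy hxy
      simp only [Prod.mk.injEq] at hxy
      exact Prod.ext (hf.1.injOn hx.1 hy.1 hxy.1) hxy.2
    · rintro ⟨u, s⟩ ⟨hu, hs⟩
      obtain ⟨q, hq, rfl⟩ := hf.1.surjOn hu
      exact ⟨(q, s), ⟨hq, hs.imp id (hfU q hq).1⟩, rfl⟩
  have hb : Set.BijOn (fun x : Plane × SignType => childPoint l r x.1 x.2) (labels (peel S)) S := by
    have := hsp.injOn.bijOn_image
    rwa [hc.image_labels] at this
  have hb' : Set.BijOn (fun x : Plane × SignType => childPoint l' r' x.1 x.2)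
      (labels (peel S')) S' := by
    have := hsp'.injOn.bijOn_image
    rwa [hc'.image_labels] at this
  exact exists_preservesOrderType_of_labelling hb (hb'.comp hlabbij)
    fun x hx y hy z hz => hsp.sign_det3_eq hsp' hf hfU hx hy hz

lemma exists_bijOn_fin_four {S : Set Plane} (hS : S.Finite) (hgp : GeneralPosition S)
    (hT : OuterTriangles S) (hcard : S.ncard = 4) : ∃ g : Fin 4 → Plane, Set.BijOn g Set.univ S ∧
      0 < det3 (g 0) (g 1) (g 2) ∧ InTri (g 3) (g 0) (g 1) (g 2) := by
  have hnt : S.Nontrivial := (Set.one_lt_ncard_iff_nontrivial_and_finite.1 (by omega)).1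
  have h2 := ncard_eq_two_mul_add_two hS hgp hT hnt
  have hV := ncard_hullVertices hS hgp hT hnt
  obtain ⟨p, hp⟩ := Set.ncard_eq_one.1 (show (peel S).ncard = 1 by omega)
  have hpp : p ∈ peel S := by rw [hp]; rfl
  obtain ⟨a, ha, b, hb, c, hc, h⟩ := exists_inTri_of_mem_peel hS hgp hpp
  have hne := ne_of_det3_pos h.det_pos
  have hinj : Function.Injective ![a, b, c, p] := by
    intro i j
    have := h.ne
    fin_cases i <;> fin_cases j <;> simp [hne, hne.1.symm, hne.2.1.symm, hne.2.2.symm, this,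
      this.1.symm, this.2.1.symm, this.2.2.symm]
  refine ⟨![a, b, c, p], ⟨?_, hinj.injOn, ?_⟩, h.det_pos, h⟩
  · intro i _
    have := hullVertices_subset S
    fin_cases i
    exacts [this ha, this hb, this hc, hpp.1]
  · have hsub : Set.range ![a, b, c, p] ⊆ S := by
      rintro _ ⟨i, rfl⟩
      have := hullVertices_subset S
      fin_cases i
      exacts [this ha, this hb, this hc, hpp.1]
    have := Set.eq_of_subset_of_ncard_le hsub (by
      rw [← Set.image_univ, Set.ncard_image_of_injective _ hinj, hcard, Set.ncard_univ]; simp) hS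
    rw [← this, Set.SurjOn, Set.image_univ]

theorem exists_preservesOrderType {S T : Set Plane} (hS : S.Finite) (hT : T.Finite)
    (hnS : IsNested S) (hnT : IsNested T) (hcard : S.ncard = T.ncard) :
    ∃ f, PreservesOrderType f S T := by
  induction hn : S.ncard using Nat.strong_induction_on generalizing S T with
  | _ n ih =>
    obtain ⟨hgp, hO, hnS'⟩ := (isNested_iff S).1 hnS
    obtain ⟨hgp', hO', hnT'⟩ := (isNested_iff T).1 hnT
    rcases le_or_gt S.ncard 2 with hle | hgt
    · obtain ⟨f, hf⟩ := hS.exists_bijOn_of_encard_eq (t := T) (by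
        rw [← hS.cast_ncard_eq, ← hT.cast_ncard_eq, hcard])
      refine ⟨f, hf, fun a ha b hb c hc => ?_⟩
      have hdup : a = b ∨ a = c ∨ b = c := by
        by_contra! hcon
        have := Set.ncard_le_ncard (s := {a, b, c}) (t := S) (by
          rintro x (rfl | rfl | rfl) <;> assumption) hS
        rw [Set.ncard_eq_three.2 ⟨a, b, c, hcon.1, hcon.2.1, hcon.2.2, rfl⟩] at this
        omega
      rcases hdup with rfl | rfl | rfl <;> simp [det3_self, det3_self', det3_self'']
    · have hnt : S.Nontrivial := (Set.one_lt_ncard_iff_nontrivial_and_finite.1 (by omega)).1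
      have hntT : T.Nontrivial := (Set.one_lt_ncard_iff_nontrivial_and_finite.1 (by omega)).1
      have c1 := ncard_eq_two_mul_add_two hS hgp hO hnt
      have c2 := ncard_eq_two_mul_add_two hT hgp' hO' hntT
      -- Children exist only when the inner part has two points. The remaining size is 4, a triangle
      -- around a single point, handled directly.
      rcases Nat.lt_or_ge 1 (peel S).ncard with h1 | h1
      · have hp : (peel S).Nontrivial := (Set.one_lt_ncard_iff_nontrivial_and_finite.1 h1).1
        have hp' : (peel T).Nontrivial :=
          (Set.one_lt_ncard_iff_nontrivial_and_finite.1 (by omega)).1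
        obtain ⟨f, hf⟩ := ih _ (by omega) (hS.subset (peel_subset S)) (hT.subset (peel_subset T))
          hnS' hnT' (by omega) rfl
        have hO1 := ((isNested_iff _).1 hnS').2.1
        have hO1' := ((isNested_iff _).1 hnT').2.1
        obtain ⟨l, r, hlr⟩ := exists_isChildren hS hgp hO hO1 hp
        obtain ⟨l', r', hlr'⟩ := exists_isChildren hT hgp' hO' hO1' hp'
        exact exists_preservesOrderType_of_isSplit hS hgp hO hO1 hT hgp' hO' hO1' hlr hlr' hf
      · obtain ⟨g, hg, hd, hI⟩ := exists_bijOn_fin_four hS hgp hO (by omega)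
        obtain ⟨g', hg', hd', hI'⟩ := exists_bijOn_fin_four hT hgp' hO' (by omega)
        refine exists_preservesOrderType_of_labelling hg hg' fun i _ j _ k _ => ?_
        refine sign_det3_eq_of_lt ?_ i j k
        have n02 : ∀ g : Fin 4 → Plane, InTri (g 3) (g 0) (g 1) (g 2) →
            det3 (g 0) (g 2) (g 3) < 0 := fun g hg => by
          have := hg.2.2
          rw [det3_swap] at this; linarith
        intro i j k hij hjk
        have hcase : (i = 0 ∧ j = 1 ∧ k = 2) ∨ (i = 0 ∧ j = 1 ∧ k = 3) ∨
            (i = 0 ∧ j = 2 ∧ k = 3) ∨ (i = 1 ∧ j = 2 ∧ k = 3) := by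
          revert i j k; decide
        rcases hcase with ⟨rfl, rfl, rfl⟩ | ⟨rfl, rfl, rfl⟩ | ⟨rfl, rfl, rfl⟩ | ⟨rfl, rfl, rfl⟩
        · rw [sign_pos hd, sign_pos hd']
        · rw [sign_pos hI.1, sign_pos hI'.1]
        · rw [sign_neg (n02 g hI), sign_neg (n02 g' hI')]
        · rw [sign_pos hI.2.1, sign_pos hI'.2.1]

/-! ### A split of a nested set is nested -/

lemma det3_ne_zero_of_lt {ι : Type*} [LinearOrder ι] {g : ι → Plane}
    (h : ∀ i j k, i < j → j < k → det3 (g i) (g j) (g k) ≠ 0) {i j k : ι} (hij : i ≠ j)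
    (hik : i ≠ k) (hjk : j ≠ k) : det3 (g i) (g j) (g k) ≠ 0 := by
  have hrot : ∀ i j k, i < j → j < k → det3 (g j) (g k) (g i) ≠ 0 := by
    intro i j k h1 h2
    rw [det3_rot]; exact h i j k h1 h2
  have hrot' : ∀ i j k, i < j → j < k → det3 (g k) (g i) (g j) ≠ 0 := by
    intro i j k h1 h2
    rw [← det3_rot]; exact h i j k h1 h2
  have hswap : ∀ i j k, det3 (g i) (g j) (g k) ≠ 0 → det3 (g j) (g i) (g k) ≠ 0 := by
    intro i j k e
    rwa [det3_swap, neg_ne_zero]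
  rcases lt_or_gt_of_ne hij with h1 | h1 <;> rcases lt_or_gt_of_ne hjk with h2 | h2 <;>
    rcases lt_or_gt_of_ne hik with h3 | h3
  · exact h i j k h1 h2
  · exact absurd (h1.trans h2) h3.asymm
  · exact hswap _ _ _ (hrot' i k j h3 h2)
  · exact hrot k i j h3 h1
  · exact hswap _ _ _ (h j i k h1 h3)
  · exact hrot' j k i h2 h3
  · exact absurd (h2.trans h1) h3.asymm
  · exact hswap _ _ _ (hrot k j i h2 h1)

lemma existsUnique_inTri_rot {T : Set Plane} {a b c : Plane}
    (h : ∃! p, p ∈ T ∧ InTri p b c a) : ∃! p, p ∈ T ∧ InTri p a b c := by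
  obtain ⟨p, ⟨hp, hpT⟩, hu⟩ := h
  exact ⟨p, ⟨hp, hpT.rot.rot⟩, fun q hq => hu q ⟨hq.1, hq.2.rot⟩⟩

lemma finite_labels {Q : Set Plane} (hQ : Q.Finite) : (labels Q).Finite :=
  (hQ.prod Set.finite_univ).subset fun _ hx => ⟨hx.1, Set.mem_univ _⟩

namespace IsSplit

variable {Q : Set Plane} {P : Plane → SignType → Plane}

lemma generalPosition (h : IsSplit Q P) (hgp : GeneralPosition Q) :
    GeneralPosition ((fun x : Plane × SignType => P x.1 x.2) '' labels Q) := by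
  have pair : ∀ x ∈ labels Q, ∀ y ∈ labels Q, ∀ z ∈ labels Q, x.1 = y.1 → x.2 ≠ y.2 →
      x.1 ≠ z.1 → det3 (P x.1 x.2) (P y.1 y.2) (P z.1 z.2) ≠ 0 := by
    rintro ⟨u, s⟩ hx ⟨w, t⟩ hy z hz hxy hst hxz
    simp only at hxy hst hxz ⊢
    subst hxy
    have hu : u ∈ hullVertices Q := by
      by_contra hu
      exact hst ((hx.2.resolve_right hu).trans (hy.2.resolve_right hu).symm)
    rcases lt_or_gt_of_ne hst with hlt | hlt
    · exact (h.pair u hu s t hlt z hz hxz.symm).ne'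
    · rw [det3_swap, neg_ne_zero]
      exact (h.pair u hu t s hlt z hz hxz.symm).ne'
  rintro _ ⟨x, hx, rfl⟩ _ ⟨y, hy, rfl⟩ _ ⟨z, hz, rfl⟩ hxy hxz hyz
  rw [collinear_iff_det3, ← Ne]
  simp only at hxy hxz hyz ⊢
  have hsnd : ∀ x y : Plane × SignType, P x.1 x.2 ≠ P y.1 y.2 → x.1 = y.1 → x.2 ≠ y.2 :=
    fun x y hne h1 h2 => hne (by rw [h1, h2])
  by_cases exy : x.1 = y.1
  · by_cases exz : x.1 = z.1
    · have n1 := hsnd x y hxy exy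
      have n2 := hsnd x z hxz exz
      have n3 := hsnd y z hyz (exy.symm.trans exz)
      rw [← exy, ← exz]
      have hu : x.1 ∈ hullVertices Q := by
        by_contra hu
        refine n1 ((hx.2.resolve_right hu).trans (hy.2.resolve_right ?_).symm)
        rwa [← exy]
      refine det3_ne_zero_of_lt (g := P x.1) ?_ n1 n2 n3
      intro i j k hij hjk
      have hi : i = -1 := by revert i j k; decide
      have hj : j = 0 := by revert i j k; decide
      have hk : k = 1 := by revert i j k; decide
      subst hi hj hk
      rw [det3_swap', neg_ne_zero, h.zero]
      exact (h.triple _ hu).ne'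
    · exact pair x hx y hy z hz exy (hsnd x y hxy exy) exz
  · by_cases exz : x.1 = z.1
    · rw [← det3_rot]
      rw [← det3_rot]
      exact pair z hz x hx y hy exz.symm (hsnd z x hxz.symm exz.symm) fun he => exy (exz.trans he)
    · by_cases eyz : y.1 = z.1
      · rw [← det3_rot]
        exact pair y hy z hz x hx eyz (hsnd y z hyz eyz) (Ne.symm exy)
      · rw [← sign_ne_zero, h.sign_eq x hx y hy z hz exy exz eyz, sign_ne_zero]
        exact hgp.det_ne hx.1 hy.1 hz.1 exy exz eyz

lemma subset_image (h : IsSplit Q P) :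
    Q ⊆ (fun x : Plane × SignType => P x.1 x.2) '' labels Q :=
  fun q hq => ⟨(q, 0), ⟨hq, Or.inl rfl⟩, h.zero q⟩

lemma isEdge (h : IsSplit Q P) {u : Plane} (hu : u ∈ hullVertices Q) :
    IsEdge ((fun x : Plane × SignType => P x.1 x.2) '' labels Q) (P u (-1)) (P u 1) := by
  have ht := h.triple u hu
  refine ⟨(ne_of_det3_pos ht).1, ?_⟩
  rintro _ ⟨⟨w, s⟩, hy, rfl⟩ hl hr
  simp only at hl hr ⊢
  by_cases hwu : w = u
  · subst hwu
    rcases s with _ | _ | _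
    · change 0 < det3 _ _ (P w 0)
      rwa [h.zero]
    · exact absurd rfl hl
    · exact absurd rfl hr
  · exact h.pair u hu (-1) 1 (by decide) (w, s) hy hwu

lemma inTri (h : IsSplit Q P) {u : Plane} (hu : u ∈ hullVertices Q) {x : Plane × SignType}
    (hx : x ∈ labels Q) (hxu : x.1 ≠ u) : InTri u (P u (-1)) (P u 1) (P x.1 x.2) := by
  have h1 := h.pair u hu (-1) 0 (by decide) x hx hxu
  have h2 := h.pair u hu 0 1 (by decide) x hx hxu
  rw [h.zero] at h1 h2
  refine ⟨h.triple u hu, ?_, ?_⟩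
  · rwa [det3_rot]
  · rwa [← det3_rot]

/-- Points with other parents all lie on one side of the line through `u` and one of its children,
so `u` is in no triangle with that child and two of them. -/
lemma not_inTri (h : IsSplit Q P) {u : Plane} (hu : u ∈ hullVertices Q) {s : SignType}
    (hs : s ≠ 0) {y z : Plane × SignType} (hy : y ∈ labels Q) (hyu : y.1 ≠ u) (hz : z ∈ labels Q)
    (hzu : z.1 ≠ u) : ¬ InTri u (P u s) (P y.1 y.2) (P z.1 z.2) := by
  rintro ⟨h1, -, h3⟩
  rcases s with _ | _ | _
  · exact hs rfl
  · have := h.pair u hu (-1) 0 (by decide) y hy hyu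
    rw [h.zero, det3_swap'] at this
    change 0 < det3 (P u (-1)) _ _ at h1
    linarith
  · have := h.pair u hu 0 1 (by decide) z hz hzu
    rw [h.zero] at this
    change 0 < det3 _ (P u 1) _ at h3
    rw [← det3_rot, det3_swap] at h3
    linarith

/-- Children are ends of hull edges. A hull vertex of `Q` is inside a triangle of its two children
and any third point with another parent; an inner point of `Q` was already inside a triangle. -/
lemma peel_image (h : IsSplit Q P) (hQ : Q.Finite) (hgp : GeneralPosition Q)
    (hnt : Q.Nontrivial) : peel ((fun x : Plane × SignType => P x.1 x.2) '' labels Q) = Q := by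
  have hS := (finite_labels hQ).image (fun x : Plane × SignType => P x.1 x.2)
  have hgpS := h.generalPosition hgp
  have hsub := h.subset_image
  apply subset_antisymm
  · rintro _ ⟨⟨⟨u, s⟩, hx, rfl⟩, hns⟩
    have key : u ∈ hullVertices Q → s = 0 := by
      intro hu
      have hm : ∀ t, P u t ∈ (fun x : Plane × SignType => P x.1 x.2) '' labels Q :=
        fun t => ⟨(u, t), ⟨hx.1, Or.inr hu⟩, rfl⟩
      have he := (h.isEdge hu).mem_hullVertices hS hgpS (hm _) (hm _)
      rcases s with _ | _ | _
      exacts [rfl, absurd he.1 hns, absurd he.2 hns]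
    have hs : s = 0 := hx.2.elim id key
    subst hs
    change P u 0 ∈ Q
    rw [h.zero]; exact hx.1
  · intro q hq
    refine ⟨hsub hq, fun hqV => ?_⟩
    by_cases hqU : q ∈ hullVertices Q
    · obtain ⟨x, hx, hxq⟩ := hnt.exists_ne q
      have hm : ∀ t, P q t ∈ (fun x : Plane × SignType => P x.1 x.2) '' labels Q :=
        fun t => ⟨(q, t), ⟨hq, Or.inr hqU⟩, rfl⟩
      exact not_inTri_of_mem_hullVertices hS hgpS hqV (hm _) (hm _)
        ⟨(x, 0), ⟨hx, Or.inl rfl⟩, rfl⟩ (h.inTri hqU (x := (x, 0)) ⟨hx, Or.inl rfl⟩ hxq)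
    · obtain ⟨a, ha, b, hb, c, hc, hT⟩ := exists_inTri_of_mem_peel hQ hgp ⟨hq, hqU⟩
      have := hullVertices_subset Q
      exact not_inTri_of_mem_hullVertices hS hgpS hqV (hsub (this ha)) (hsub (this hb))
        (hsub (this hc)) hT

lemma inTri_iff (h : IsSplit Q P) {q : Plane} (hq : q ∈ Q) {x y z : Plane × SignType}
    (hx : x ∈ labels Q) (hy : y ∈ labels Q) (hz : z ∈ labels Q) (hxy : x.1 ≠ y.1)
    (hxz : x.1 ≠ z.1) (hyz : y.1 ≠ z.1) (hqx : q ≠ x.1) (hqy : q ≠ y.1) (hqz : q ≠ z.1) :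
    InTri q (P x.1 x.2) (P y.1 y.2) (P z.1 z.2) ↔ InTri q x.1 y.1 z.1 := by
  have key : ∀ x ∈ labels Q, ∀ y ∈ labels Q, x.1 ≠ y.1 → q ≠ x.1 → q ≠ y.1 →
      (0 < det3 (P x.1 x.2) (P y.1 y.2) q ↔ 0 < det3 x.1 y.1 q) := by
    intro x hx y hy hxy hqx hqy
    have := h.sign_eq x hx y hy (q, 0) ⟨hq, Or.inl rfl⟩ hxy hqx.symm hqy.symm
    simp only [h.zero] at this
    rw [← sign_eq_one_iff, this, sign_eq_one_iff]
  unfold InTri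
  rw [key x hx y hy hxy hqx hqy, key y hy z hz hyz hqy hqz, key z hz x hx hxz.symm hqz hqx]

/-- All vertices of such a triangle are children. With two children of the same `u` it contains only
`u`; with three different parents it contains the same points of `Q` as the triangle of the parents.
-/
lemma outerTriangles (h : IsSplit Q P) (hQ : Q.Finite) (hgp : GeneralPosition Q)
    (hnt : Q.Nontrivial) (hT : OuterTriangles Q) :
    OuterTriangles ((fun x : Plane × SignType => P x.1 x.2) '' labels Q) := by
  have hpeel := h.peel_image hQ hgp hnt
  have hlab : ∀ a ∈ hullVertices ((fun x : Plane × SignType => P x.1 x.2) '' labels Q),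
      ∃ x ∈ labels Q, x.2 ≠ 0 ∧ x.1 ∈ hullVertices Q ∧ P x.1 x.2 = a := by
    intro a ha
    obtain ⟨x, hx, rfl⟩ := hullVertices_subset _ ha
    have hx0 : x.2 ≠ 0 := by
      intro h0
      have hxp : x.1 ∈ peel ((fun x : Plane × SignType => P x.1 x.2) '' labels Q) := by
        rw [hpeel]; exact hx.1
      simp only [h0, h.zero] at ha
      exact hxp.2 ha
    exact ⟨x, hx, hx0, hx.2.resolve_left hx0, rfl⟩
  have two : ∀ x ∈ labels Q, ∀ y ∈ labels Q, ∀ z ∈ labels Q, x.2 ≠ 0 → y.2 ≠ 0 → z.2 ≠ 0 →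
      x.1 ∈ hullVertices Q → z.1 ∈ hullVertices Q → x.1 = y.1 → x.1 ≠ z.1 →
      0 < det3 (P x.1 x.2) (P y.1 y.2) (P z.1 z.2) →
      ∃! p, p ∈ Q ∧ InTri p (P x.1 x.2) (P y.1 y.2) (P z.1 z.2) := by
    rintro ⟨u, s⟩ hx ⟨w, t⟩ hy z hz hs ht hz0 hu hzU huw huz hd
    simp only at hs ht hu huw huz hd ⊢
    subst huw
    have hst : s = -1 ∧ t = 1 := by
      rcases s with _ | _ | _ <;> rcases t with _ | _ | _
      · exact absurd rfl hs
      · exact absurd rfl hs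
      · exact absurd rfl hs
      · exact absurd rfl ht
      · simp [det3_self''] at hd
      · exact ⟨rfl, rfl⟩
      · exact absurd rfl ht
      · have := h.pair u hu (-1) 1 (by decide) z hz huz.symm
        rw [det3_swap] at this
        change 0 < det3 (P u 1) (P u (-1)) _ at hd
        linarith
      · simp [det3_self''] at hd
    obtain ⟨rfl, rfl⟩ := hst
    refine ⟨u, ⟨hx.1, h.inTri hu hz huz.symm⟩, ?_⟩
    rintro q ⟨hq, hqT⟩
    by_contra hqu
    by_cases hqz : q = z.1
    · subst hqz
      exact h.not_inTri hzU hz0 hx huz hy huz hqT.rot.rot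
    -- Replacing all labels by parents would put `q` on both sides of the line through `u` and
    -- `z.1`.
    have e1 := h.sign_eq (u, 1) hy z hz (q, 0) ⟨hq, Or.inl rfl⟩ huz (Ne.symm hqu) (Ne.symm hqz)
    have e2 := h.sign_eq z hz (u, -1) hx (q, 0) ⟨hq, Or.inl rfl⟩ huz.symm (Ne.symm hqz)
      (Ne.symm hqu)
    simp only [h.zero] at e1 e2
    rw [sign_pos hqT.2.1, eq_comm, sign_eq_one_iff] at e1
    rw [sign_pos hqT.2.2, eq_comm, sign_eq_one_iff, det3_swap] at e2
    linarith
  intro a ha b hb c hc hd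
  rw [hpeel]
  obtain ⟨x, hx, hx0, hxU, rfl⟩ := hlab a ha
  obtain ⟨y, hy, hy0, hyU, rfl⟩ := hlab b hb
  obtain ⟨z, hz, hz0, hzU, rfl⟩ := hlab c hc
  by_cases hxy : x.1 = y.1
  · by_cases hxz : x.1 = z.1
    · exfalso
      have hn := ne_of_det3_pos hd
      rw [← hxy, ← hxz] at hn
      have e : ∀ s t s' : SignType, s ≠ 0 → t ≠ 0 → s' ≠ 0 → s = t ∨ s = s' ∨ t = s' := by decide
      rcases e x.2 y.2 z.2 hx0 hy0 hz0 with he | he | he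
      · exact hn.1 (by rw [he])
      · exact hn.2.1 (by rw [he])
      · exact hn.2.2 (by rw [he])
    · exact two x hx y hy z hz hx0 hy0 hz0 hxU hzU hxy hxz hd
  · by_cases hxz : x.1 = z.1
    · refine existsUnique_inTri_rot (existsUnique_inTri_rot ?_)
      refine two z hz x hx y hy hz0 hx0 hy0 hzU hyU hxz.symm (fun he => hxy (hxz.trans he)) ?_
      rwa [← det3_rot]
    · by_cases hyz : y.1 = z.1
      · refine existsUnique_inTri_rot ?_
        refine two y hy z hz x hx hy0 hz0 hx0 hyU hxU hyz (Ne.symm hxy) ?_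
        rwa [det3_rot]
      · have hd' := h.sign_eq x hx y hy z hz hxy hxz hyz
        rw [sign_pos hd, eq_comm, sign_eq_one_iff] at hd'
        obtain ⟨p, ⟨hp, hpT⟩, huniq⟩ := hT _ hxU _ hyU _ hzU hd'
        have hpne : ∀ v ∈ hullVertices Q, p ≠ v := fun v hv he => hp.2 (he ▸ hv)
        refine ⟨p, ⟨hp.1, ?_⟩, ?_⟩
        · exact (h.inTri_iff hp.1 hx hy hz hxy hxz hyz (hpne _ hxU) (hpne _ hyU)
            (hpne _ hzU)).2 hpT
        · rintro q ⟨hq, hqT⟩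
          have nx : q ≠ x.1 := by
            rintro rfl
            exact h.not_inTri hxU hx0 hy (Ne.symm hxy) hz (Ne.symm hxz) hqT
          have ny : q ≠ y.1 := by
            rintro rfl
            exact h.not_inTri hyU hy0 hz (Ne.symm hyz) hx hxy hqT.rot
          have nz : q ≠ z.1 := by
            rintro rfl
            exact h.not_inTri hzU hz0 hx hxz hy hyz hqT.rot.rot
          have hqT' := (h.inTri_iff hq hx hy hz hxy hxz hyz nx ny nz).1 hqT
          have := hullVertices_subset Q
          exact huniq q ⟨⟨hq, fun hqU => not_inTri_of_mem_hullVertices hQ hgp hqU (this hxU)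
            (this hyU) (this hzU) hqT'⟩, hqT'⟩

end IsSplit

/-! ### Realising a split by perturbation -/

lemma exists_supporting_functional {Q : Set Plane} (hQ : Q.Finite) (hgp : GeneralPosition Q)
    {u : Plane} (hu : u ∈ hullVertices Q) :
    ∃ α β : ℝ, ∀ z ∈ Q, z ≠ u → 0 < α * (z 0 - u 0) + β * (z 1 - u 1) := by
  have hfin : (Q \ {u}).Finite := hQ.subset Set.sdiff_subset
  have hnot : u ∉ convexHull ℝ (Q \ {u}) := by
    intro hmem
    have huQ := hullVertices_subset Q hu
    obtain ⟨a, ha, b, hb, c, hc, h⟩ := exists_inTri_of_mem_convexHull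
      (hgp.mono (Set.insert_subset huQ Set.sdiff_subset)) (by simp) hmem
    exact not_inTri_of_mem_hullVertices hQ hgp hu ha.1 hb.1 hc.1 h
  obtain ⟨f, m, hfu, hf⟩ := geometric_hahn_banach_point_closed (convex_convexHull ℝ _)
    (hfin.isCompact_convexHull ℝ).isClosed hnot
  refine ⟨f !₂[1, 0], f !₂[0, 1], fun z hz hzu => ?_⟩
  have h1 := hf z (subset_convexHull ℝ _ ⟨hz, hzu⟩)
  have h2 : z - u = (z 0 - u 0) • (!₂[1, 0] : Plane) + (z 1 - u 1) • (!₂[0, 1] : Plane) := by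
    ext i
    fin_cases i <;> simp
  have h3 : f z - f u = (z 0 - u 0) * f !₂[1, 0] + (z 1 - u 1) * f !₂[0, 1] := by
    rw [← map_sub, h2, map_add, map_smul, map_smul, smul_eq_mul, smul_eq_mul]
  nlinarith

/-- The point `u + s ε t - s² ε² n` with `n = (α, β)` and `t = (β, -α)`. -/
noncomputable def perturb (α β : Plane → ℝ) (ε : ℝ) (u : Plane) (s : SignType) : Plane :=
  !₂[u 0 + s * ε * β u - (s : ℝ) ^ 2 * ε ^ 2 * α u, u 1 - s * ε * α u - (s : ℝ) ^ 2 * ε ^ 2 * β u]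

lemma continuous_perturb (α β : Plane → ℝ) (u : Plane) (s : SignType) :
    Continuous fun ε => perturb α β ε u s := by
  unfold perturb
  refine (PiLp.continuous_toLp 2 _).comp (continuous_pi fun i => ?_)
  fin_cases i
  · simp; fun_prop
  · simp; fun_prop

lemma perturb_zero_left (α β : Plane → ℝ) (u : Plane) (s : SignType) :
    perturb α β 0 u s = u := by
  ext i
  fin_cases i <;> simp [perturb]

lemma perturb_zero_right (α β : Plane → ℝ) (ε : ℝ) (u : Plane) : perturb α β ε u 0 = u := by
  ext i
  fin_cases i <;> simp [perturb]

lemma eventually_sign_det3_perturb (α β : Plane → ℝ) (x y z : Plane × SignType)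
    (hne : det3 x.1 y.1 z.1 ≠ 0) : ∀ᶠ ε in nhds (0 : ℝ),
      SignType.sign (det3 (perturb α β ε x.1 x.2) (perturb α β ε y.1 y.2)
        (perturb α β ε z.1 z.2)) = SignType.sign (det3 x.1 y.1 z.1) := by
  have hc := (continuous_det3 (continuous_perturb α β x.1 x.2) (continuous_perturb α β y.1 y.2)
    (continuous_perturb α β z.1 z.2)).tendsto 0
  simp only [perturb_zero_left] at hc
  rcases lt_or_gt_of_ne hne with h | h
  · filter_upwards [hc.eventually_lt_const h] with ε hε
    rw [sign_neg h, sign_neg hε]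
  · filter_upwards [hc.eventually_const_lt h] with ε hε
    rw [sign_pos h, sign_pos hε]

/-- The determinant is `ε` times a continuous function whose value at 0 is `t - s` times the
supporting functional at `y.1`. -/
lemma eventually_det3_perturb_pos (α β : Plane → ℝ) (u : Plane) {s t : SignType} (hst : s < t)
    (y : Plane × SignType) (hy : 0 < α u * (y.1 0 - u 0) + β u * (y.1 1 - u 1)) :
    ∀ᶠ ε in nhdsWithin (0 : ℝ) (Set.Ioi 0),
      0 < det3 (perturb α β ε u s) (perturb α β ε u t) (perturb α β ε y.1 y.2) := by
  have hst' : (0 : ℝ) < t - s := by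
    revert s t
    intro s t hst
    rcases s with _ | _ | _ <;> rcases t with _ | _ | _ <;>
      first
      | exact absurd hst (by decide)
      | simp
  set G : ℝ → ℝ := fun ε =>
    ((t - s) * β u - ((t : ℝ) ^ 2 - (s : ℝ) ^ 2) * ε * α u) *
      (perturb α β ε y.1 y.2 1 - perturb α β ε u s 1) +
    ((t - s) * α u + ((t : ℝ) ^ 2 - (s : ℝ) ^ 2) * ε * β u) *
      (perturb α β ε y.1 y.2 0 - perturb α β ε u s 0) with hG
  have hdet : ∀ ε, det3 (perturb α β ε u s) (perturb α β ε u t) (perturb α β ε y.1 y.2) =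
      ε * G ε := by
    intro ε
    simp only [hG, det3]
    have e0 : perturb α β ε u t 0 - perturb α β ε u s 0 =
        ε * ((t - s) * β u - ((t : ℝ) ^ 2 - (s : ℝ) ^ 2) * ε * α u) := by
      simp [perturb]; ring
    have e1 : perturb α β ε u t 1 - perturb α β ε u s 1 =
        -(ε * ((t - s) * α u + ((t : ℝ) ^ 2 - (s : ℝ) ^ 2) * ε * β u)) := by
      simp [perturb]; ring
    rw [e0, e1]; ring
  have hGc : Continuous G := by
    have c1 := continuous_perturb α β y.1 y.2
    have c2 := continuous_perturb α β u s
    fun_prop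
  have hG0 : 0 < G 0 := by
    simp only [hG, perturb_zero_left]
    have := mul_pos hst' hy
    nlinarith
  have hev := ((hGc.tendsto 0).eventually_const_lt hG0).filter_mono
    (nhdsWithin_le_nhds (s := Set.Ioi 0))
  filter_upwards [hev, self_mem_nhdsWithin] with ε h1 h2
  rw [hdet]
  exact mul_pos h2 h1

/-- Each orientation condition holds for all small positive `ε`, and there are finitely many of
them. -/
lemma exists_isSplit {Q : Set Plane} (hQ : Q.Finite) (hgp : GeneralPosition Q)
    (hnt : Q.Nontrivial) : ∃ P, IsSplit Q P := by
  choose! α β hαβ using fun u hu => exists_supporting_functional hQ hgp (u := u) hu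
  have hL := finite_labels hQ
  have h1 : ∀ᶠ ε in nhdsWithin (0 : ℝ) (Set.Ioi 0), ∀ x ∈ labels Q, ∀ y ∈ labels Q,
      ∀ z ∈ labels Q, x.1 ≠ y.1 → x.1 ≠ z.1 → y.1 ≠ z.1 →
      SignType.sign (det3 (perturb α β ε x.1 x.2) (perturb α β ε y.1 y.2)
        (perturb α β ε z.1 z.2)) = SignType.sign (det3 x.1 y.1 z.1) := by
    refine (Filter.eventually_all_finite hL).2 fun x hx =>
      (Filter.eventually_all_finite hL).2 fun y hy =>
      (Filter.eventually_all_finite hL).2 fun z hz => ?_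
    by_cases hne : x.1 ≠ y.1 ∧ x.1 ≠ z.1 ∧ y.1 ≠ z.1
    · filter_upwards [(eventually_sign_det3_perturb α β x y z
        (hgp.det_ne hx.1 hy.1 hz.1 hne.1 hne.2.1 hne.2.2)).filter_mono nhdsWithin_le_nhds]
        with ε hε _ _ _ using hε
    · exact Filter.Eventually.of_forall fun ε a b c => absurd ⟨a, b, c⟩ hne
  have h2 : ∀ᶠ ε in nhdsWithin (0 : ℝ) (Set.Ioi 0), ∀ u ∈ hullVertices Q, ∀ s t : SignType,
      s < t → ∀ y ∈ labels Q, y.1 ≠ u →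
      0 < det3 (perturb α β ε u s) (perturb α β ε u t) (perturb α β ε y.1 y.2) := by
    refine (Filter.eventually_all_finite (hQ.subset (hullVertices_subset Q))).2 fun u hu =>
      Filter.eventually_all.2 fun s => Filter.eventually_all.2 fun t => ?_
    by_cases hst : s < t
    · have : ∀ᶠ ε in nhdsWithin (0 : ℝ) (Set.Ioi 0), ∀ y ∈ labels Q, y.1 ≠ u →
          0 < det3 (perturb α β ε u s) (perturb α β ε u t) (perturb α β ε y.1 y.2) := by
        refine (Filter.eventually_all_finite hL).2 fun y hy => ?_
        by_cases hyu : y.1 = u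
        · exact Filter.Eventually.of_forall fun ε a => absurd hyu a
        · filter_upwards [eventually_det3_perturb_pos α β u hst y (hαβ u hu y.1 hy.1 hyu)]
            with ε hε _ using hε
      filter_upwards [this] with ε hε _ using hε
    · exact Filter.Eventually.of_forall fun ε a => absurd a hst
  obtain ⟨ε, ⟨hε1, hε2⟩, hε⟩ := ((h1.and h2).and self_mem_nhdsWithin).exists
  refine ⟨perturb α β ε, perturb_zero_right α β ε, hε1, hε2, fun u hu => ?_⟩
  have hpos : 0 < α u ^ 2 + β u ^ 2 := by
    obtain ⟨z, hz, hzu⟩ := hnt.exists_ne u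
    have := hαβ u hu z hz hzu
    by_contra! hcon
    have ha : α u = 0 := by nlinarith [sq_nonneg (α u), sq_nonneg (β u)]
    have hb : β u = 0 := by nlinarith [sq_nonneg (α u), sq_nonneg (β u)]
    simp [ha, hb] at this
  -- The first-order displacements leave `u` on the line of its children; the quadratic term pushes
  -- both outwards, leaving `u` strictly on the inner side.
  have e : det3 (perturb α β ε u (-1)) (perturb α β ε u 1) u =
      2 * ε ^ 3 * (α u ^ 2 + β u ^ 2) := by
    simp [det3, perturb]; ring
  rw [e]
  have : (0 : ℝ) < ε := hε
  positivity

lemma exists_isNested_double {Q : Set Plane} (hQ : Q.Finite) (hn : IsNested Q)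
    (hnt : Q.Nontrivial) : ∃ S : Set Plane, S.Finite ∧ IsNested S ∧ S.ncard = 2 * Q.ncard + 2 := by
  obtain ⟨hgp, hT, -⟩ := (isNested_iff Q).1 hn
  obtain ⟨P, hP⟩ := exists_isSplit hQ hgp hnt
  have hS := (finite_labels hQ).image (fun x : Plane × SignType => P x.1 x.2)
  have hgpS := hP.generalPosition hgp
  have hTS := hP.outerTriangles hQ hgp hnt hT
  have hpeel := hP.peel_image hQ hgp hnt
  refine ⟨_, hS, (isNested_iff _).2 ⟨hgpS, hTS, by rwa [hpeel]⟩, ?_⟩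
  rw [ncard_eq_two_mul_add_two hS hgpS hTS (hnt.mono hP.subset_image), hpeel]

/-! ### Small sets and the possible sizes -/

lemma isNested_of_ncard_le_two {S : Set Plane} (hS : S.Finite) (h : S.ncard ≤ 2) :
    IsNested S := by
  have hno : ∀ a ∈ S, ∀ b ∈ S, ∀ c ∈ S, a ≠ b → a ≠ c → b ≠ c → False := by
    intro a ha b hb c hc hab hac hbc
    have := Set.ncard_le_ncard (s := {a, b, c}) (t := S) (by
      rintro x (rfl | rfl | rfl) <;> assumption) hS
    rw [Set.ncard_eq_three.2 ⟨a, b, c, hab, hac, hbc, rfl⟩] at this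
    omega
  refine ⟨fun a ha b hb c hc hab hac hbc => (hno a ha b hb c hc hab hac hbc).elim, fun i => ?_⟩
  have hsub := (hullVertices_subset _).trans (peel_iterate_subset S i)
  intro a ha b hb c hc hd
  have hne := ne_of_det3_pos hd
  exact (hno a (hsub ha) b (hsub hb) c (hsub hc) hne.1 hne.2.1 hne.2.2).elim

lemma exists_isNested_of_le_two {n : ℕ} (hn : n ≤ 2) :
    ∃ S : Set Plane, S.Finite ∧ IsNested S ∧ S.ncard = n := by
  have : Infinite Plane := Module.Free.infinite ℝ Plane
  obtain ⟨s, hs⟩ := Infinite.exists_subset_card_eq Plane n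
  have hc : (s : Set Plane).ncard = n := by rw [Set.ncard_coe_finset, hs]
  exact ⟨s, s.finite_toSet, isNested_of_ncard_le_two s.finite_toSet (by omega), hc⟩

lemma isNested_of_triangle {a b c p : Plane} (h : InTri p a b c) :
    IsNested {a, b, c, p} ∧ ({a, b, c, p} : Set Plane).ncard = 4 := by
  have hd := h.det_pos
  have hne := ne_of_det3_pos hd
  have hpne := h.ne
  set S : Set Plane := {a, b, c, p} with hSdef
  have hS : S.Finite := by simp [hSdef]
  have hgp : GeneralPosition S := by
    have hr : ∀ x ∈ S, ∃ i, ![a, b, c, p] i = x := by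
      rintro x (rfl | rfl | rfl | rfl)
      exacts [⟨0, rfl⟩, ⟨1, rfl⟩, ⟨2, rfl⟩, ⟨3, rfl⟩]
    intro x hx y hy z hz hxy hxz hyz
    obtain ⟨i, rfl⟩ := hr x hx
    obtain ⟨j, rfl⟩ := hr y hy
    obtain ⟨k, rfl⟩ := hr z hz
    rw [collinear_iff_det3, ← Ne]
    refine det3_ne_zero_of_lt ?_ (fun e => hxy (by rw [e])) (fun e => hxz (by rw [e]))
      (fun e => hyz (by rw [e]))
    intro i j k hij hjk
    have hcase : (i = 0 ∧ j = 1 ∧ k = 2) ∨ (i = 0 ∧ j = 1 ∧ k = 3) ∨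
        (i = 0 ∧ j = 2 ∧ k = 3) ∨ (i = 1 ∧ j = 2 ∧ k = 3) := by
      revert i j k; decide
    rcases hcase with ⟨rfl, rfl, rfl⟩ | ⟨rfl, rfl, rfl⟩ | ⟨rfl, rfl, rfl⟩ | ⟨rfl, rfl, rfl⟩
    · exact hd.ne'
    · exact h.1.ne'
    · have := h.2.2
      rw [det3_swap] at this
      exact (neg_pos.1 this).ne
    · exact h.2.1.ne'
  have edge : ∀ {a b c : Plane}, InTri p a b c → ∀ {T : Set Plane}, T ⊆ {a, b, c, p} →
      IsEdge T a b := by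
    intro a b c h T hT
    refine ⟨(ne_of_det3_pos h.1).1, fun z hz hza hzb => ?_⟩
    rcases hT hz with rfl | rfl | rfl | rfl
    exacts [absurd rfl hza, absurd rfl hzb, h.det_pos, h.1]
  have e1 : IsEdge S a b := edge h subset_rfl
  have e2 : IsEdge S b c := edge h.rot (by rw [hSdef]; intro x; simp; tauto)
  have haS : a ∈ S := by simp [hSdef]
  have hbS : b ∈ S := by simp [hSdef]
  have hcS : c ∈ S := by simp [hSdef]
  have hpS : p ∈ S := by simp [hSdef]
  have haV := (e1.mem_hullVertices hS hgp haS hbS).1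
  have hbcV := e2.mem_hullVertices hS hgp hbS hcS
  have hpV : p ∉ hullVertices S := fun hp =>
    not_inTri_of_mem_hullVertices hS hgp hp haS hbS hcS h
  have hpeel : peel S = {p} := by
    ext x
    constructor
    · rintro ⟨rfl | rfl | rfl | rfl, hx⟩
      exacts [absurd haV hx, absurd hbcV.1 hx, absurd hbcV.2 hx, rfl]
    · rintro rfl
      exact ⟨hpS, hpV⟩
  have hV : ∀ x ∈ hullVertices S, x = a ∨ x = b ∨ x = c := by
    intro x hx
    rcases hullVertices_subset S hx with rfl | rfl | rfl | rfl
    exacts [Or.inl rfl, Or.inr (Or.inl rfl), Or.inr (Or.inr rfl), absurd hx hpV]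
  refine ⟨(isNested_iff S).2 ⟨hgp, ?_, ?_⟩, ?_⟩
  · intro x hx y hy z hz hxyz
    rw [hpeel]
    refine ⟨p, ⟨rfl, ?_⟩, fun q hq => hq.1⟩
    have hn := ne_of_det3_pos hxyz
    have s1 := det3_swap a b c
    have s2 := det3_swap' a b c
    have s3 := det3_swap b c a
    have s4 := det3_rot a b c
    have s5 := det3_rot b c a
    have s6 := det3_rot a c b
    rcases hV x hx with rfl | rfl | rfl <;> rcases hV y hy with rfl | rfl | rfl <;>
      rcases hV z hz with rfl | rfl | rfl <;>
      first
      | exact h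
      | exact h.rot
      | exact h.rot.rot
      | exact absurd rfl hn.1
      | exact absurd rfl hn.2.1
      | exact absurd rfl hn.2.2
      | (exfalso; linarith)
  · rw [hpeel]
    exact isNested_of_ncard_le_two (Set.finite_singleton p) (by simp)
  · rw [hSdef, Set.ncard_insert_of_notMem, Set.ncard_eq_three.2 ⟨b, c, p, hne.2.2, hpne.2.1.symm,
      hpne.2.2.symm, rfl⟩]
    simp [hne.1, hne.2.1, hpne.1.symm]

lemma exists_isNested_four : ∃ S : Set Plane, S.Finite ∧ IsNested S ∧ S.ncard = 4 := by
  have h : InTri (!₂[0, 0] : Plane) !₂[-1, -1] !₂[1, -1] !₂[0, 2] := by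
    refine ⟨?_, ?_, ?_⟩ <;> norm_num [det3]
  exact ⟨_, by simp, isNested_of_triangle h⟩

lemma exists_isNested (j : ℕ) :
    (∃ S : Set Plane, S.Finite ∧ IsNested S ∧ S.ncard + 2 = 2 ^ (j + 1)) ∧
    (∃ S : Set Plane, S.Finite ∧ IsNested S ∧ S.ncard + 2 = 3 * 2 ^ j) := by
  -- Doubling needs at least two points, that is `m ≥ 4`; the passages from 0 to 2 and from 1 to 4
  -- points are made by hand.
  have step : ∀ m : ℕ, 4 ≤ m →
      (∃ S : Set Plane, S.Finite ∧ IsNested S ∧ S.ncard + 2 = m) →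
      ∃ S : Set Plane, S.Finite ∧ IsNested S ∧ S.ncard + 2 = 2 * m := by
    rintro m hm ⟨Q, hQ, hn, hc⟩
    obtain ⟨S, hS, hnS, hcS⟩ := exists_isNested_double hQ hn
      (Set.one_lt_ncard_iff_nontrivial_and_finite.1 (by omega)).1
    exact ⟨S, hS, hnS, by omega⟩
  constructor
  · induction j with
    | zero =>
      obtain ⟨S, hS, hn, hc⟩ := exists_isNested_of_le_two (n := 0) (by norm_num)
      exact ⟨S, hS, hn, by omega⟩
    | succ j ih =>
      rcases Nat.eq_zero_or_pos j with rfl | hj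
      · obtain ⟨S, hS, hn, hc⟩ := exists_isNested_of_le_two (n := 2) (by norm_num)
        exact ⟨S, hS, hn, by omega⟩
      · have : 2 ^ (1 + 1) ≤ 2 ^ (j + 1) := Nat.pow_le_pow_right (by norm_num) (by omega)
        obtain ⟨S, hS, hn, hc⟩ := step _ (by omega) ih
        exact ⟨S, hS, hn, by rw [hc]; ring⟩
  · induction j with
    | zero =>
      obtain ⟨S, hS, hn, hc⟩ := exists_isNested_of_le_two (n := 1) (by norm_num)
      exact ⟨S, hS, hn, by omega⟩
    | succ j ih =>
      rcases Nat.eq_zero_or_pos j with rfl | hj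
      · obtain ⟨S, hS, hn, hc⟩ := exists_isNested_four
        exact ⟨S, hS, hn, by omega⟩
      · have : 2 ^ 1 ≤ 2 ^ j := Nat.pow_le_pow_right (by norm_num) (by omega)
        obtain ⟨S, hS, hn, hc⟩ := step _ (by omega) ih
        exact ⟨S, hS, hn, by rw [hc]; ring⟩

/-- The quantity `|S| + 2` doubles with each added layer, starting from 2 or 3. -/
lemma IsNested.ncard {S : Set Plane} (hS : S.Finite) (h : IsNested S) :
    ∃ j, S.ncard + 2 = 2 ^ (j + 1) ∨ S.ncard + 2 = 3 * 2 ^ j := by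
  induction hn : S.ncard using Nat.strong_induction_on generalizing S with
  | _ n ih =>
    obtain ⟨hgp, hT, h'⟩ := (isNested_iff S).1 h
    rcases Nat.lt_or_ge n 2 with h2 | h2
    · exact ⟨0, by omega⟩
    · have hc := ncard_eq_two_mul_add_two hS hgp hT
        (Set.one_lt_ncard_iff_nontrivial_and_finite.1 (by omega)).1
      obtain ⟨j, hj⟩ := ih _ (by omega) (hS.subset (peel_subset S)) h' rfl
      refine ⟨j + 1, ?_⟩
      rw [pow_succ, pow_succ _ j]
      omega

lemma PreservesOrderType.sameOrderType {X Y : Finset Plane} {f : Plane → Plane}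
    (h : PreservesOrderType f X Y) : SameOrderType X Y :=
  ⟨h.1.equiv f, fun a b c => h.2 a a.2 b b.2 c c.2⟩

theorem theorem1 (n : ℕ) :
    ((∃ k : ℕ, 1 ≤ k ∧ ((n : ℤ) = 2 ^ (k - 1) - 2 ∨ (n : ℤ) = 3 * 2 ^ (k - 1) - 2)) →
      (∃ X : Finset Plane, X.card = n ∧ IsNestedAlmostConvex X) ∧
      (∀ X Y : Finset Plane, X.card = n → Y.card = n →
        IsNestedAlmostConvex X → IsNestedAlmostConvex Y → SameOrderType X Y)) ∧
    ((¬ ∃ k : ℕ, 1 ≤ k ∧ ((n : ℤ) = 2 ^ (k - 1) - 2 ∨ (n : ℤ) = 3 * 2 ^ (k - 1) - 2)) →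
      ¬ ∃ X : Finset Plane, X.card = n ∧ IsNestedAlmostConvex X) := by
  refine ⟨?_, ?_⟩
  · rintro ⟨k, hk, hn⟩
    constructor
    · have hS : ∃ S : Set Plane, S.Finite ∧ IsNested S ∧ S.ncard = n := by
        rcases hn with hn | hn
        · have hn' : n + 2 = 2 ^ (k - 1) := by
            have : ((n + 2 : ℕ) : ℤ) = ((2 ^ (k - 1) : ℕ) : ℤ) := by push_cast; linarith
            exact_mod_cast this
          -- For `k = 1` the first family would give `n = -1`.
          obtain ⟨j, hj⟩ : ∃ j, k - 1 = j + 1 := by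
            refine Nat.exists_eq_succ_of_ne_zero fun h0 => ?_
            rw [h0] at hn'; omega
          obtain ⟨S, hS, hnS, hc⟩ := (exists_isNested j).1
          rw [hj] at hn'
          exact ⟨S, hS, hnS, by omega⟩
        · have hn' : n + 2 = 3 * 2 ^ (k - 1) := by
            have : ((n + 2 : ℕ) : ℤ) = ((3 * 2 ^ (k - 1) : ℕ) : ℤ) := by push_cast; linarith
            exact_mod_cast this
          obtain ⟨S, hS, hnS, hc⟩ := (exists_isNested (k - 1)).2
          exact ⟨S, hS, hnS, by omega⟩
      obtain ⟨S, hS, hnS, hc⟩ := hS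
      lift S to Finset Plane using hS
      exact ⟨S, by rwa [Set.ncard_coe_finset] at hc, (isNestedAlmostConvex_iff S).2 hnS⟩
    · intro X Y hX hY hnX hnY
      obtain ⟨f, hf⟩ := exists_preservesOrderType X.finite_toSet Y.finite_toSet
        ((isNestedAlmostConvex_iff X).1 hnX) ((isNestedAlmostConvex_iff Y).1 hnY)
        (by rw [Set.ncard_coe_finset, Set.ncard_coe_finset, hX, hY])
      exact hf.sameOrderType
  · rintro hno ⟨X, hX, hnX⟩
    obtain ⟨j, hj⟩ := IsNested.ncard X.finite_toSet ((isNestedAlmostConvex_iff X).1 hnX)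
    rw [Set.ncard_coe_finset, hX] at hj
    rcases hj with hj | hj
    · refine hno ⟨j + 2, by omega, Or.inl ?_⟩
      have : ((n + 2 : ℕ) : ℤ) = ((2 ^ (j + 1) : ℕ) : ℤ) := by rw [hj]
      push_cast at this
      rw [show j + 2 - 1 = j + 1 by omega]
      linarith
    · refine hno ⟨j + 1, by omega, Or.inr ?_⟩
      have : ((n + 2 : ℕ) : ℤ) = ((3 * 2 ^ j : ℕ) : ℤ) := by rw [hj]
      push_cast at this
      rw [show j + 1 - 1 = j by omega]
      linarith
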